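/- Theorem (closed subgroup theorem). Let $G$ be a smooth real finite-dimensional Lie group (Hausdorff and second countable), with identity $e$ and Lie algebra $\mathfrak g=T_eG$, whose bracket is that of left-invariant vector fields. For $X\in\mathfrak g$ let $\exp(X)=\lambda_X(1)$, where $\lambda_X:\mathbb R\to G$ is the unique smooth group homomorphism with $\lambda_X'(0)=X$. Let $H\subset G$ be a subgroup that is closed as a subset of $G$. Then: (1) $H$ is an embedded Lie subgroup of $G$: with the subspace topology, $H$ carries, for some $k\ge 0$, the structure of a smooth $k$-dimensional manifold for which multiplication and inversion on $H$ are smooth and the inclusion $i:H\hookrightarrow G$ is a smooth embedding (a smooth immersion that is a homeomorphism onto its image). (2) The Lie algebra of $H$ is $\mathfrak h=\{X\in\mathfrak g:\exp(tX)\in H\text{ for all }t\in\mathbb R\}$. That is, $\mathfrak h$ is a Lie subalgebra of $\mathfrak g$, and for every structure on $H$ as in (1) the differential $\mathrm d i_e$ is an isomorphism of Lie algebras from $T_eH$ onto $\mathfrak h$. -/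

import Mathlib

open scoped Manifold ContDiff

/-- Smooth real Lie groups are `C^3`; this makes Mathlib's Lie algebra structure on
`GroupLieAlgebra I G` available for them. -/
instance instLEInftyMinSmoothnessRealThree : ENat.LEInfty (minSmoothness ℝ 3) := by
  rw [minSmoothness_of_isRCLikeNormedField]
  infer_instance

/-- `γ : ℝ → G` is a one-parameter subgroup of the Lie group `G` (a smooth group homomorphism from
`(ℝ, +)` to `G`) with initial velocity `γ'(0) = X`. As `γ 0 = 1`, this velocity lives in the
tangent space to `G` at the identity. -/
structure IsOneParameterSubgroup {E : Type*} [NormedAddCommGroup E] [NormedSpace ℝ E]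
    {G : Type*} [TopologicalSpace G] [ChartedSpace E G] [Group G]
    (X : GroupLieAlgebra 𝓘(ℝ, E) G) (γ : ℝ → G) : Prop where
  map_add : ∀ s t : ℝ, γ (s + t) = γ s * γ t
  contMDiff : ContMDiff 𝓘(ℝ, ℝ) 𝓘(ℝ, E) ∞ γ
  velocity : (mfderiv 𝓘(ℝ, ℝ) 𝓘(ℝ, E) γ 0 (1 : ℝ) : E) = X

open Classical in
/-- The Lie exponential map: `exp X = γ 1` where `γ` is the one-parameter subgroup of `G` with
`γ'(0) = X`. On a Lie group there is exactly one such `γ` for every `X`, so that the default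
value `1` is never taken. -/
noncomputable def lieExp {E : Type*} [NormedAddCommGroup E] [NormedSpace ℝ E]
    {G : Type*} [TopologicalSpace G] [ChartedSpace E G] [Group G]
    (X : GroupLieAlgebra 𝓘(ℝ, E) G) : G :=
  if h : ∃ γ : ℝ → G, IsOneParameterSubgroup X γ then h.choose 1 else 1

/-- The subgroup `H` of `G`, with its subspace topology and a given smooth atlas of dimension `k`,
is an embedded Lie subgroup of `G`: it is a Lie group, and the inclusion is a smooth embedding
(a smooth immersion that is a homeomorphism onto its image). Requiring the subspace topology on
`H` loses nothing: it is the only one for which the inclusion is a topological embedding. -/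
structure IsEmbeddedLieSubgroup (E : Type*) [NormedAddCommGroup E] [NormedSpace ℝ E]
    {G : Type*} [TopologicalSpace G] [ChartedSpace E G] [Group G] (H : Subgroup G)
    (k : ℕ) [ChartedSpace (EuclideanSpace ℝ (Fin k)) H] : Prop where
  lieGroup : LieGroup (𝓡 k) ∞ H
  isSmoothEmbedding : Manifold.IsSmoothEmbedding (𝓡 k) 𝓘(ℝ, E) ∞ (Subtype.val : H → G)

/-! Everything rests on `subgroupTangent E H`, the velocities X of one-parameter subgroups lying in
H. Let φ be the chart at the identity. The analytic core is `exists_tendsto_pow_floor`: if g_n → 1,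
c_n → ∞ and c_n (φ(g_n) − φ(1)) → X, then g_n ^ ⌊c_n t⌋ → γ(t) for small t ≥ 0, where γ is the
one-parameter subgroup with velocity X. This is convergence of an Euler scheme, proved by a discrete
Grönwall estimate. If every g_n lies in the closed subgroup H, so does the limit, and X belongs to
the tangent set.

Two consequences follow. Sampling γ(s)η(s) at s = 1/(n+1) shows that the tangent set is closed under
addition, hence a linear subspace. And if C is a complement of it, elements of H cannot approach 1
along C, since a limit of their normalised coordinates would be a unit vector in both spaces.

Let σ(t) be a product of one-parameter subgroups of H along a basis of the tangent space. By the
inverse function theorem (t, Y) ↦ σ(t) · φ⁻¹(φ(1) + Y), with Y in C, gives coordinates near 1. As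
σ(t) lies in H, the product lies in H only for Y = 0: H is a slice. Left translation moves this
chart to every point of H, and the group operations are smooth because continuous maps into H are
smooth once they are smooth into G.

For the Lie algebra, the differential of the inclusion is injective by uniqueness of one-parameter
subgroups, its range is the tangent set because curves in H corestrict smoothly, and it preserves
brackets because left-invariant fields are related by a homomorphism. Smoothness of exp in X is
never needed. -/

/-! ### One-parameter subgroups as integral curves of left-invariant fields -/

section OneParameter

open Set Filter Topology

variable {E : Type*} [NormedAddCommGroup E] [NormedSpace ℝ E]
  {G : Type*} [TopologicalSpace G] [ChartedSpace E G] [Group G] [LieGroup 𝓘(ℝ, E) ∞ G]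

-- Tangent spaces at equal points all unfold to `E`, but dependent types obstruct rewriting the base
-- point. Reading values in `E` allows the change.
omit [Group G] [LieGroup 𝓘(ℝ, E) ∞ G] in
lemma mfderiv_apply_congr_point {E' M : Type*} [NormedAddCommGroup E'] [NormedSpace ℝ E']
    [TopologicalSpace M] [ChartedSpace E' M] {f : M → G} {x y : M} (hxy : x = y) (v : E') :
    (mfderiv 𝓘(ℝ, E') 𝓘(ℝ, E) f x v : E) = mfderiv 𝓘(ℝ, E') 𝓘(ℝ, E) f y v := by
  subst hxy; rfl

lemma mfderiv_mul_left_mulInvariantVectorField (X : GroupLieAlgebra 𝓘(ℝ, E) G) (g h : G) :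
    mfderiv 𝓘(ℝ, E) 𝓘(ℝ, E) (g * ·) h (mulInvariantVectorField X h) =
      mulInvariantVectorField X (g * h) := by
  have hsm : ∀ a b : G, MDifferentiableAt 𝓘(ℝ, E) 𝓘(ℝ, E) (a * ·) b := fun a b =>
    (contMDiff_mul_left (I := 𝓘(ℝ, E)) (n := ∞) (a := a)).contMDiffAt.mdifferentiableAt (by simp)
  have key : (fun x : G => g * h * x) = (fun x => g * x) ∘ (fun x => h * x) := by
    ext x; simp [mul_assoc]
  have h2 := mfderiv_comp_of_eq (I := 𝓘(ℝ, E)) (I' := 𝓘(ℝ, E)) (I'' := 𝓘(ℝ, E)) (x := (1 : G))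
    (hsm g h) (hsm h 1) (mul_one h)
  rw [← key] at h2
  refine Eq.trans ?_ (congrArg (fun L => (L X : E)) h2).symm
  exact (mfderiv_apply_congr_point (f := (g * ·)) (mul_one h) _).symm

lemma IsMIntegralCurveOn.mul_left {X : GroupLieAlgebra 𝓘(ℝ, E) G} {γ : ℝ → G} {s : Set ℝ}
    (hγ : IsMIntegralCurveOn γ (mulInvariantVectorField X) s) (g : G) :
    IsMIntegralCurveOn (fun t => g * γ t) (mulInvariantVectorField X) s := by
  intro t ht
  have hsm : MDifferentiableAt 𝓘(ℝ, E) 𝓘(ℝ, E) (g * ·) (γ t) :=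
    (contMDiff_mul_left (I := 𝓘(ℝ, E)) (n := ∞) (a := g)).contMDiffAt.mdifferentiableAt (by simp)
  have := hsm.hasMFDerivAt.comp_hasMFDerivWithinAt t (hγ t ht)
  refine this.congr_mfderiv ?_
  refine ContinuousLinearMap.ext fun a => ?_
  have h3 := mfderiv_mul_left_mulInvariantVectorField X g (γ t)
  have h4 := (mfderiv 𝓘(ℝ, E) 𝓘(ℝ, E) (g * ·) (γ t)).map_smul a (mulInvariantVectorField X (γ t))
  rw [h3] at h4
  exact h4

omit [LieGroup 𝓘(ℝ, E) ∞ G] in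
lemma IsOneParameterSubgroup.map_zero {X : GroupLieAlgebra 𝓘(ℝ, E) G} {γ : ℝ → G}
    (hγ : IsOneParameterSubgroup X γ) : γ 0 = 1 := by
  have := hγ.map_add 0 0
  simpa using this

/-- Differentiate γ(u) = γ(t) γ(u − t) at u = t: the velocity at t is the left translate of the
velocity at 0. -/
lemma IsOneParameterSubgroup.isMIntegralCurve {X : GroupLieAlgebra 𝓘(ℝ, E) G} {γ : ℝ → G}
    (hγ : IsOneParameterSubgroup X γ) : IsMIntegralCurve γ (mulInvariantVectorField X) := by
  intro t
  have h0 : γ 0 = 1 := hγ.map_zero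
  have hd : MDifferentiableAt 𝓘(ℝ, ℝ) 𝓘(ℝ, E) γ 0 :=
    hγ.contMDiff.contMDiffAt.mdifferentiableAt (by simp)
  have hsm : MDifferentiableAt 𝓘(ℝ, E) 𝓘(ℝ, E) (γ t * ·) (γ 0) :=
    (contMDiff_mul_left (I := 𝓘(ℝ, E)) (n := ∞) (a := γ t)).contMDiffAt.mdifferentiableAt (by simp)
  have h1 := hsm.hasMFDerivAt.comp (0 : ℝ) hd.hasMFDerivAt
  have hsub : HasMFDerivAt 𝓘(ℝ, ℝ) 𝓘(ℝ, ℝ) (fun u : ℝ => u - t) t (ContinuousLinearMap.id ℝ ℝ) :=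
    ((hasFDerivAt_id t).sub_const t).hasMFDerivAt
  set D : ℝ →L[ℝ] E := (mfderiv 𝓘(ℝ, E) 𝓘(ℝ, E) (γ t * ·) (γ 0)).comp
    (mfderiv 𝓘(ℝ, ℝ) 𝓘(ℝ, E) γ 0) with hD
  have h1' : ∀ r : ℝ, r = 0 → HasMFDerivAt 𝓘(ℝ, ℝ) 𝓘(ℝ, E) ((fun x => γ t * x) ∘ γ) r D := by
    rintro _ rfl; exact h1
  have h2 := HasMFDerivAt.comp t (f := fun u : ℝ => u - t) (h1' _ (sub_self t)) hsub
  have he : γ = ((fun x => γ t * x) ∘ γ) ∘ (fun u : ℝ => u - t) := by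
    ext u; simp [← hγ.map_add]
  rw [← he] at h2
  refine h2.congr_mfderiv ?_
  refine ContinuousLinearMap.ext fun (a : ℝ) => ?_
  have h4 := (mfderiv 𝓘(ℝ, ℝ) 𝓘(ℝ, E) γ 0).map_smul a (1 : ℝ)
  have h5 := (mfderiv 𝓘(ℝ, E) 𝓘(ℝ, E) (γ t * ·) (1 : G)).map_smul a X
  have h6 : (mfderiv 𝓘(ℝ, ℝ) 𝓘(ℝ, E) γ 0 a : E) = a • (X : E) := by
    rw [← hγ.velocity]
    refine Eq.trans ?_ h4
    exact congrArg (fun z : ℝ => (mfderiv 𝓘(ℝ, ℝ) 𝓘(ℝ, E) γ 0 z : E)) (mul_one a).symm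
  refine (mfderiv_apply_congr_point (E := E) (E' := E) (f := (γ t * ·)) h0
    (mfderiv 𝓘(ℝ, ℝ) 𝓘(ℝ, E) γ 0 a)).trans ?_
  rw [h6]
  exact h5

lemma contMDiff_one_mulInvariantVectorField (X : GroupLieAlgebra 𝓘(ℝ, E) G) :
    ContMDiff 𝓘(ℝ, E) (𝓘(ℝ, E).prod 𝓘(ℝ, E)) 1
      (fun g : G => (⟨g, mulInvariantVectorField X g⟩ : TangentBundle 𝓘(ℝ, E) G)) := by
  refine (contMDiff_mulInvariantVectorField X).of_le ?_
  exact le_trans (by norm_num) le_minSmoothness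

lemma IsOneParameterSubgroup.unique [CompleteSpace E] [T2Space G]
    {X : GroupLieAlgebra 𝓘(ℝ, E) G} {γ γ' : ℝ → G}
    (hγ : IsOneParameterSubgroup X γ) (hγ' : IsOneParameterSubgroup X γ') : γ = γ' :=
  isMIntegralCurve_Ioo_eq_of_contMDiff_boundaryless (t₀ := 0)
    (contMDiff_one_mulInvariantVectorField X) hγ.isMIntegralCurve hγ'.isMIntegralCurve
    (hγ.map_zero.trans hγ'.map_zero.symm)

lemma exists_isMIntegralCurve_mulInvariantVectorField [CompleteSpace E] [T2Space G]
    (X : GroupLieAlgebra 𝓘(ℝ, E) G) :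
    ∃ γ : ℝ → G, γ 0 = 1 ∧ IsMIntegralCurve γ (mulInvariantVectorField X) := by
  have hV := contMDiff_one_mulInvariantVectorField X
  obtain ⟨γ, h0, hγ⟩ := exists_isMIntegralCurveAt_of_contMDiffAt_boundaryless (t₀ := 0)
    (hV.contMDiffAt (x := 1))
  obtain ⟨ε, hε, h⟩ := isMIntegralCurveAt_iff'.1 hγ
  rw [Real.ball_eq_Ioo, zero_sub, zero_add] at h
  -- Left translates of one local solution start at every point and live on the same interval, so
  -- the existence time is uniform and the field is complete.
  refine exists_isMIntegralCurve_of_isMIntegralCurveOn hV hε (fun g => ?_) 1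
  exact ⟨fun t => g * γ t, by simp [h0], h.mul_left g⟩

/-- As functions of t, both sides are integral curves of the same field starting at γ(s). -/
lemma IsMIntegralCurve.map_add [CompleteSpace E] [T2Space G]
    {X : GroupLieAlgebra 𝓘(ℝ, E) G} {γ : ℝ → G} (h0 : γ 0 = 1)
    (hγ : IsMIntegralCurve γ (mulInvariantVectorField X)) (s t : ℝ) :
    γ (s + t) = γ s * γ t := by
  have h1 : IsMIntegralCurve (fun t => γ s * γ t) (mulInvariantVectorField X) := by
    rw [isMIntegralCurve_iff_isMIntegralCurveOn] at hγ ⊢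
    exact hγ.mul_left _
  have h2 := hγ.comp_add s
  have := isMIntegralCurve_Ioo_eq_of_contMDiff_boundaryless (t₀ := 0)
    (contMDiff_one_mulInvariantVectorField X) h2 h1 (by simp [h0])
  have := congrFun this t
  simpa [add_comm] using this

end OneParameter

/-! ### Multiplication in a chart, and smoothness of one-parameter subgroups -/

section Coordinates

open Set Filter Topology

variable {E : Type*} [NormedAddCommGroup E] [NormedSpace ℝ E]
  {G : Type*} [TopologicalSpace G] [ChartedSpace E G] [Group G]

variable (E G) in
/-- The group multiplication read in the preferred chart at the identity. -/
noncomputable def coordMul (p : E × E) : E :=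
  extChartAt 𝓘(ℝ, E) (1 : G)
    ((extChartAt 𝓘(ℝ, E) (1 : G)).symm p.1 * (extChartAt 𝓘(ℝ, E) (1 : G)).symm p.2)

variable (E G) in
/-- The domain on which `coordMul` computes the product of the group. -/
def coordMulDomain : Set (E × E) :=
  {p | p.1 ∈ (extChartAt 𝓘(ℝ, E) (1 : G)).target ∧ p.2 ∈ (extChartAt 𝓘(ℝ, E) (1 : G)).target ∧
    (extChartAt 𝓘(ℝ, E) (1 : G)).symm p.1 * (extChartAt 𝓘(ℝ, E) (1 : G)).symm p.2 ∈
      (extChartAt 𝓘(ℝ, E) (1 : G)).source}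

lemma mem_coordMulDomain_left {x : E} (hx : x ∈ (extChartAt 𝓘(ℝ, E) (1 : G)).target) :
    (x, extChartAt 𝓘(ℝ, E) (1 : G) 1) ∈ coordMulDomain E G := by
  refine ⟨hx, mem_extChartAt_target _, ?_⟩
  simpa using (extChartAt 𝓘(ℝ, E) (1 : G)).map_target hx

lemma coordMul_left {x : E} (hx : x ∈ (extChartAt 𝓘(ℝ, E) (1 : G)).target) :
    coordMul E G (x, extChartAt 𝓘(ℝ, E) (1 : G) 1) = x := by
  simpa [coordMul] using (extChartAt 𝓘(ℝ, E) (1 : G)).right_inv hx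

lemma coordMul_right {x : E} (hx : x ∈ (extChartAt 𝓘(ℝ, E) (1 : G)).target) :
    coordMul E G (extChartAt 𝓘(ℝ, E) (1 : G) 1, x) = x := by
  simpa [coordMul] using (extChartAt 𝓘(ℝ, E) (1 : G)).right_inv hx

lemma coordMul_apply {g h : G} (hg : g ∈ (extChartAt 𝓘(ℝ, E) (1 : G)).source)
    (hh : h ∈ (extChartAt 𝓘(ℝ, E) (1 : G)).source) :
    coordMul E G (extChartAt 𝓘(ℝ, E) (1 : G) g, extChartAt 𝓘(ℝ, E) (1 : G) h) =
      extChartAt 𝓘(ℝ, E) (1 : G) (g * h) := by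
  rw [coordMul, PartialEquiv.left_inv _ hg, PartialEquiv.left_inv _ hh]

variable [LieGroup 𝓘(ℝ, E) ∞ G]

lemma isOpen_coordMulDomain : IsOpen (coordMulDomain E G) := by
  have : IsTopologicalGroup G := topologicalGroup_of_lieGroup 𝓘(ℝ, E) ∞
  have ht : IsOpen (extChartAt 𝓘(ℝ, E) (1 : G)).target := isOpen_extChartAt_target _
  have hs : IsOpen (extChartAt 𝓘(ℝ, E) (1 : G)).source := isOpen_extChartAt_source _
  have hc := continuousOn_extChartAt_symm (I := 𝓘(ℝ, E)) (1 : G)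
  have hm : ContinuousOn (fun p : E × E => (extChartAt 𝓘(ℝ, E) (1 : G)).symm p.1 *
      (extChartAt 𝓘(ℝ, E) (1 : G)).symm p.2)
      ((extChartAt 𝓘(ℝ, E) (1 : G)).target ×ˢ (extChartAt 𝓘(ℝ, E) (1 : G)).target) :=
    (hc.comp continuousOn_fst fun p hp => hp.1).mul (hc.comp continuousOn_snd fun p hp => hp.2)
  convert! hm.isOpen_inter_preimage (ht.prod ht) hs using 1
  ext p
  simp [coordMulDomain, and_assoc]

lemma contDiffOn_coordMul : ContDiffOn ℝ ∞ (coordMul E G) (coordMulDomain E G) := by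
  rw [← contMDiffOn_iff_contDiffOn]
  have hs := contMDiffOn_extChartAt_symm (I := 𝓘(ℝ, E)) (n := ∞) (1 : G)
  have hc := contMDiffOn_extChartAt (I := 𝓘(ℝ, E)) (n := ∞) (x := (1 : G))
  have h1 : ContMDiffOn 𝓘(ℝ, E × E) 𝓘(ℝ, E) ∞
      (fun p : E × E => (extChartAt 𝓘(ℝ, E) (1 : G)).symm p.1) (coordMulDomain E G) :=
    hs.comp (contDiff_fst.contMDiff.contMDiffOn) fun p hp => hp.1
  have h2 : ContMDiffOn 𝓘(ℝ, E × E) 𝓘(ℝ, E) ∞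
      (fun p : E × E => (extChartAt 𝓘(ℝ, E) (1 : G)).symm p.2) (coordMulDomain E G) :=
    hs.comp (contDiff_snd.contMDiff.contMDiffOn) fun p hp => hp.2.1
  refine hc.comp (h1.mul h2) fun p hp => ?_
  simpa using hp.2.2

lemma contDiffAt_coordMul {p : E × E} (hp : p ∈ coordMulDomain E G) :
    ContDiffAt ℝ ∞ (coordMul E G) p :=
  contDiffOn_coordMul.contDiffAt (isOpen_coordMulDomain.mem_nhds hp)

/-- The partial derivatives are identities because the coordinate e of the unit is neutral: m(x, e)
= x and m(e, y) = y near e. -/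
lemma fderiv_coordMul_one (u v : E) :
    fderiv ℝ (coordMul E G) (extChartAt 𝓘(ℝ, E) (1 : G) 1, extChartAt 𝓘(ℝ, E) (1 : G) 1) (u, v) =
      u + v := by
  set e := extChartAt 𝓘(ℝ, E) (1 : G) 1 with he
  have ht : (extChartAt 𝓘(ℝ, E) (1 : G)).target ∈ 𝓝 e := extChartAt_target_mem_nhds _
  have hd : HasFDerivAt (coordMul E G) (fderiv ℝ (coordMul E G) (e, e)) (e, e) :=
    ((contDiffAt_coordMul (mem_coordMulDomain_left
      (mem_extChartAt_target _))).differentiableAt (by simp)).hasFDerivAt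
  have h1 := hd.comp (f := fun x => (id x, e)) e ((hasFDerivAt_id e).prodMk (hasFDerivAt_const e e))
  have h2 := hd.comp (f := fun x => (e, id x)) e ((hasFDerivAt_const e e).prodMk (hasFDerivAt_id e))
  have h1' : HasFDerivAt (coordMul E G ∘ fun x => (id x, e)) (ContinuousLinearMap.id ℝ E) e :=
    (hasFDerivAt_id e).congr_of_eventuallyEq (by
      filter_upwards [ht] with x hx
      exact coordMul_left hx)
  have h2' : HasFDerivAt (coordMul E G ∘ fun x => (e, id x)) (ContinuousLinearMap.id ℝ E) e :=
    (hasFDerivAt_id e).congr_of_eventuallyEq (by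
      filter_upwards [ht] with x hx
      exact coordMul_right hx)
  have e1 := congrArg (fun L => L u) (h1.unique h1')
  have e2 := congrArg (fun L => L v) (h2.unique h2')
  simp at e1 e2
  have : (u, v) = (u, (0 : E)) + ((0 : E), v) := by simp
  rw [this, map_add, e1, e2]

omit [Group G] [LieGroup 𝓘(ℝ, E) ∞ G] in
lemma HasMFDerivAt.hasFDerivAt_extChartAt_comp {F : Type*} [NormedAddCommGroup F] [NormedSpace ℝ F]
    {f : F → G} {x : F} {g : G} {D : F →L[ℝ] E} (hfx : f x = g)
    (hf : HasMFDerivAt 𝓘(ℝ, F) 𝓘(ℝ, E) f x D) :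
    HasFDerivAt (extChartAt 𝓘(ℝ, E) g ∘ f) D x := by
  subst hfx
  have : HasFDerivWithinAt (E := F) (F := E) (writtenInExtChartAt 𝓘(ℝ, F) 𝓘(ℝ, E) x f) D
    (range 𝓘(ℝ, F)) (extChartAt 𝓘(ℝ, F) x x) := hf.2
  refine hasFDerivWithinAt_univ.1 ?_
  simpa [writtenInExtChartAt, chartAt_self_eq, -hasFDerivWithinAt_univ] using this

omit [LieGroup 𝓘(ℝ, E) ∞ G] in
lemma mulInvariantVectorField_one (X : GroupLieAlgebra 𝓘(ℝ, E) G) :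
    mulInvariantVectorField X (1 : G) = X := by
  have h : (fun x : G => 1 * x) = id := by ext x; simp
  rw [mulInvariantVectorField, h, mfderiv_id]
  rfl

omit [LieGroup 𝓘(ℝ, E) ∞ G] in
lemma IsOneParameterSubgroup.hasDerivAt {X : GroupLieAlgebra 𝓘(ℝ, E) G} {γ : ℝ → G}
    (hγ : IsOneParameterSubgroup X γ) :
    HasDerivAt (extChartAt 𝓘(ℝ, E) (1 : G) ∘ γ) (X : E) 0 := by
  have hd : MDifferentiableAt 𝓘(ℝ, ℝ) 𝓘(ℝ, E) γ 0 :=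
    hγ.contMDiff.contMDiffAt.mdifferentiableAt (by simp)
  have := (HasMFDerivAt.hasFDerivAt_extChartAt_comp hγ.map_zero hd.hasMFDerivAt).hasDerivAt
  exact this.congr_deriv hγ.velocity

/-- Differentiate γ(t + s) = γ(t) γ(s) in s at 0. The derivative depends only on the position
φ(γ(t)), so the curve solves an autonomous equation with smooth right-hand side. -/
lemma hasDerivAt_extChartAt_comp_of_map_add {X : E} {γ : ℝ → G}
    (h0 : γ 0 = 1) (hadd : ∀ s t, γ (s + t) = γ s * γ t) (hcont : Continuous γ)
    (hX : HasDerivAt (extChartAt 𝓘(ℝ, E) (1 : G) ∘ γ) X 0) {t : ℝ}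
    (ht : γ t ∈ (extChartAt 𝓘(ℝ, E) (1 : G)).source) :
    HasDerivAt (extChartAt 𝓘(ℝ, E) (1 : G) ∘ γ)
      (fderiv ℝ (coordMul E G)
        (extChartAt 𝓘(ℝ, E) (1 : G) (γ t), extChartAt 𝓘(ℝ, E) (1 : G) 1) (0, X)) t := by
  set φ := extChartAt 𝓘(ℝ, E) (1 : G) with hφ
  have hd : HasFDerivAt (coordMul E G) (fderiv ℝ (coordMul E G) (φ (γ t), φ 1)) (φ (γ t), φ 1) :=
    ((contDiffAt_coordMul (mem_coordMulDomain_left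
      (φ.map_source ht))).differentiableAt (by simp)).hasFDerivAt
  have h1 : HasDerivAt (fun s => (φ (γ t), (φ ∘ γ) s)) (0, X) 0 := (hasDerivAt_const _ _).prodMk hX
  have h2 : HasDerivAt (fun s => coordMul E G (φ (γ t), (φ ∘ γ) s))
      (fderiv ℝ (coordMul E G) (φ (γ t), φ 1) (0, X)) 0 :=
    HasFDerivAt.comp_hasDerivAt_of_eq 0 hd h1 (by simp [h0])
  have h3 : HasDerivAt (fun s => (φ ∘ γ) (t + s))
      (fderiv ℝ (coordMul E G) (φ (γ t), φ 1) (0, X)) 0 := by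
    refine h2.congr_of_eventuallyEq ?_
    have : ∀ᶠ s in 𝓝 (0 : ℝ), γ s ∈ φ.source :=
      hcont.continuousAt.eventually (by rw [h0]; exact extChartAt_source_mem_nhds _)
    filter_upwards [this] with s hs
    simp only [Function.comp_apply, hadd]
    exact (coordMul_apply ht hs).symm
  have h4 := HasDerivAt.scomp_of_eq (h := fun u : ℝ => u - t) t h3 ((hasDerivAt_id t).sub_const t)
    (sub_self t).symm
  rw [one_smul] at h4
  refine h4.congr_of_eventuallyEq (Eventually.of_forall fun u => ?_)
  simp

/-- Differentiability at 0 suffices: the autonomous equation bootstraps smoothness near 0, and γ(u)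
= γ(t) γ(u − t) carries it to every t. -/
lemma contMDiff_of_map_add [CompleteSpace E] {X : E} {γ : ℝ → G}
    (h0 : γ 0 = 1) (hadd : ∀ s t, γ (s + t) = γ s * γ t) (hcont : Continuous γ)
    (hX : HasDerivAt (extChartAt 𝓘(ℝ, E) (1 : G) ∘ γ) X 0) :
    ContMDiff 𝓘(ℝ, ℝ) 𝓘(ℝ, E) ∞ γ := by
  set φ := extChartAt 𝓘(ℝ, E) (1 : G) with hφ
  have hsrc : ∀ᶠ s in 𝓝 (0 : ℝ), γ s ∈ φ.source :=
    hcont.continuousAt.eventually (by rw [h0]; exact extChartAt_source_mem_nhds _)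
  obtain ⟨ε, hε, hball⟩ := Metric.eventually_nhds_iff_ball.1 hsrc
  have hI : ∀ t ∈ Icc (-(ε / 2)) (ε / 2), γ t ∈ φ.source := fun t ht =>
    hball t (by rw [Real.ball_eq_Ioo]; exact ⟨by linarith [ht.1], by linarith [ht.2]⟩)
  have hopen : IsOpen φ.target := isOpen_extChartAt_target _
  have hW : ContDiffOn ℝ ∞ (fun x : E => fderiv ℝ (coordMul E G) (x, φ 1) (0, X)) φ.target := by
    have h1 : ContDiffOn ℝ ∞ (fderiv ℝ (coordMul E G)) (coordMulDomain E G) :=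
      contDiffOn_coordMul.fderiv_of_isOpen isOpen_coordMulDomain (by simp)
    have h2 : ContDiffOn ℝ ∞ (fun x : E => (x, φ 1)) φ.target := by fun_prop
    exact (h1.comp h2 fun x hx => mem_coordMulDomain_left hx).clm_apply contDiffOn_const
  have hγ0 : ContDiffOn ℝ ∞ (φ ∘ γ) (Icc (-(ε / 2)) (ε / 2)) := by
    refine ODE.contDiffOn_enat_Icc_of_hasDerivWithinAt (n := ⊤) (u := φ.target)
      (f := fun _ x => fderiv ℝ (coordMul E G) (x, φ 1) (0, X)) ?_ ?_ ?_
    · exact hW.comp contDiffOn_snd fun p hp => hp.2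
    · exact fun t ht =>
        (hasDerivAt_extChartAt_comp_of_map_add h0 hadd hcont hX (hI t ht)).hasDerivWithinAt
    · exact fun t ht => φ.map_source (hI t ht)
  have hat0 : ContMDiffAt 𝓘(ℝ, ℝ) 𝓘(ℝ, E) ∞ γ 0 := by
    have h1 : ContMDiffAt 𝓘(ℝ, ℝ) 𝓘(ℝ, E) ∞ (φ ∘ γ) 0 :=
      (hγ0.contDiffAt (Icc_mem_nhds (by linarith) (by linarith))).contMDiffAt
    have h2 : ContMDiffAt 𝓘(ℝ, E) 𝓘(ℝ, E) ∞ φ.symm ((φ ∘ γ) 0) := by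
      refine (contMDiffOn_extChartAt_symm (I := 𝓘(ℝ, E)) (n := ∞) (1 : G)).contMDiffAt ?_
      simp only [Function.comp_apply, h0]
      exact extChartAt_target_mem_nhds _
    refine (h2.comp (0 : ℝ) h1).congr_of_eventuallyEq ?_
    filter_upwards [hsrc] with s hs
    simp [φ.left_inv hs]
  intro t
  have he : γ = (fun x => γ t * x) ∘ γ ∘ (fun u : ℝ => u - t) := by
    ext u; simp [← hadd]
  rw [he]
  refine (contMDiff_mul_left (I := 𝓘(ℝ, E)) (n := ∞) (a := γ t)).contMDiffAt.comp t ?_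
  refine ContMDiffAt.comp_of_eq (f := fun u : ℝ => u - t) hat0 ?_ (sub_self t)
  exact (contDiff_id.sub contDiff_const).contMDiff.contMDiffAt

lemma exists_isOneParameterSubgroup [CompleteSpace E] [T2Space G]
    (X : GroupLieAlgebra 𝓘(ℝ, E) G) : ∃ γ : ℝ → G, IsOneParameterSubgroup X γ := by
  obtain ⟨γ, h0, hγ⟩ := exists_isMIntegralCurve_mulInvariantVectorField X
  have hadd := IsMIntegralCurve.map_add h0 hγ
  have hX := (HasMFDerivAt.hasFDerivAt_extChartAt_comp h0 (hγ 0)).hasDerivAt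
  have hsm := contMDiff_of_map_add h0 hadd hγ.continuous hX
  refine ⟨γ, hadd, hsm, ?_⟩
  rw [(hγ 0).mfderiv]
  have : ∀ g : G, g = 1 → (mulInvariantVectorField X g : E) = X := by
    rintro _ rfl; exact mulInvariantVectorField_one X
  exact (one_smul ℝ (mulInvariantVectorField X (γ 0) : E)).trans (this _ h0)

lemma isOneParameterSubgroup_of_hasDerivAt [CompleteSpace E] {X : E} {γ : ℝ → G}
    (h0 : γ 0 = 1) (hadd : ∀ s t, γ (s + t) = γ s * γ t) (hcont : Continuous γ)
    (hX : HasDerivAt (extChartAt 𝓘(ℝ, E) (1 : G) ∘ γ) X 0) :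
    IsOneParameterSubgroup (X : GroupLieAlgebra 𝓘(ℝ, E) G) γ := by
  have hsm := contMDiff_of_map_add h0 hadd hcont hX
  refine ⟨hadd, hsm, ?_⟩
  have hd : MDifferentiableAt 𝓘(ℝ, ℝ) 𝓘(ℝ, E) γ 0 := hsm.contMDiffAt.mdifferentiableAt (by simp)
  exact (HasMFDerivAt.hasFDerivAt_extChartAt_comp h0 hd.hasMFDerivAt).hasDerivAt.unique hX

lemma IsOneParameterSubgroup.comp_mul [CompleteSpace E] {X : GroupLieAlgebra 𝓘(ℝ, E) G} {γ : ℝ → G}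
    (hγ : IsOneParameterSubgroup X γ) (a : ℝ) :
    IsOneParameterSubgroup (a • X) (fun t => γ (a * t)) := by
  have key : ∀ Y : E, HasDerivAt (extChartAt 𝓘(ℝ, E) (1 : G) ∘ γ) Y 0 →
      HasDerivAt (extChartAt 𝓘(ℝ, E) (1 : G) ∘ fun t => γ (a * t)) (a • Y) 0 := fun Y hY => by
    have := HasDerivAt.scomp_of_eq (h := fun u : ℝ => a * u) 0 hY
      ((hasDerivAt_id (0 : ℝ)).const_mul a) (by simp)
    rwa [mul_one] at this
  exact isOneParameterSubgroup_of_hasDerivAt (by simp [hγ.map_zero])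
    (fun s t => by rw [mul_add, hγ.map_add])
    (hγ.contMDiff.continuous.comp (continuous_const.mul continuous_id)) (key X hγ.hasDerivAt)

lemma IsOneParameterSubgroup.lieExp_eq [CompleteSpace E] [T2Space G]
    {X : GroupLieAlgebra 𝓘(ℝ, E) G} {γ : ℝ → G} (hγ : IsOneParameterSubgroup X γ) :
    lieExp X = γ 1 := by
  have h : ∃ γ : ℝ → G, IsOneParameterSubgroup X γ := ⟨γ, hγ⟩
  rw [lieExp, dif_pos h, h.choose_spec.unique hγ]

lemma IsOneParameterSubgroup.lieExp_smul [CompleteSpace E] [T2Space G]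
    {X : GroupLieAlgebra 𝓘(ℝ, E) G} {γ : ℝ → G} (hγ : IsOneParameterSubgroup X γ) (t : ℝ) :
    lieExp (t • X) = γ t := by
  rw [(hγ.comp_mul t).lieExp_eq, mul_one]

end Coordinates

/-! ### Powers of elements near the identity: convergence of the Euler scheme -/

section Euler

open Set Filter Topology

variable {E : Type*} [NormedAddCommGroup E] [NormedSpace ℝ E]
  {G : Type*} [TopologicalSpace G] [ChartedSpace E G] [Group G] [LieGroup 𝓘(ℝ, E) ∞ G]

lemma fderiv_coordMul_left {x : E} (hx : x ∈ (extChartAt 𝓘(ℝ, E) (1 : G)).target) (u : E) :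
    fderiv ℝ (coordMul E G) (x, extChartAt 𝓘(ℝ, E) (1 : G) 1) (u, 0) = u := by
  set e := extChartAt 𝓘(ℝ, E) (1 : G) 1 with he
  have ht : (extChartAt 𝓘(ℝ, E) (1 : G)).target ∈ 𝓝 x :=
    (isOpen_extChartAt_target (I := 𝓘(ℝ, E)) (1 : G)).mem_nhds hx
  have hd : HasFDerivAt (coordMul E G) (fderiv ℝ (coordMul E G) (x, e)) (x, e) :=
    ((contDiffAt_coordMul (mem_coordMulDomain_left hx)).differentiableAt (by simp)).hasFDerivAt
  have h1 := hd.comp (f := fun x => (id x, e)) x ((hasFDerivAt_id x).prodMk (hasFDerivAt_const e x))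
  have h1' : HasFDerivAt (coordMul E G ∘ fun x => (id x, e)) (ContinuousLinearMap.id ℝ E) x :=
    (hasFDerivAt_id x).congr_of_eventuallyEq (by
      filter_upwards [ht] with x hx
      exact coordMul_left hx)
  simpa using congrArg (fun L => L u) (h1.unique h1')

-- Right multiplication by a is the identity when a = e, so its derivative differs from the identity
-- by at most a multiple of ‖a − e‖. The factor 1 + L‖a − e‖, rather than a fixed Lipschitz
-- constant, keeps the error bounded when the estimate is iterated about 1/‖a − e‖ times.
variable (E G) in
lemma exists_norm_coordMul_sub_le :
    ∃ L : ℝ, 0 ≤ L ∧ ∃ r : ℝ, 0 < r ∧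
      (∀ x ∈ Metric.ball (extChartAt 𝓘(ℝ, E) (1 : G) 1) r,
        ∀ y ∈ Metric.ball (extChartAt 𝓘(ℝ, E) (1 : G) 1) r, (x, y) ∈ coordMulDomain E G) ∧
      ∀ x ∈ Metric.ball (extChartAt 𝓘(ℝ, E) (1 : G) 1) r,
      ∀ y ∈ Metric.ball (extChartAt 𝓘(ℝ, E) (1 : G) 1) r,
      ∀ a ∈ Metric.ball (extChartAt 𝓘(ℝ, E) (1 : G) 1) r,
      ∀ b ∈ Metric.ball (extChartAt 𝓘(ℝ, E) (1 : G) 1) r,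
        ‖coordMul E G (x, a) - coordMul E G (y, b)‖ ≤
          (1 + L * ‖a - extChartAt 𝓘(ℝ, E) (1 : G) 1‖) * ‖x - y‖ + L * ‖a - b‖ := by
  set e := extChartAt 𝓘(ℝ, E) (1 : G) 1 with he
  have hee : (e, e) ∈ coordMulDomain E G := mem_coordMulDomain_left (mem_extChartAt_target _)
  have hC : ContDiffAt ℝ 1 (coordMul E G) (e, e) := (contDiffAt_coordMul hee).of_le (by simp)
  have hC' : ContDiffAt ℝ 1 (fderiv ℝ (coordMul E G)) (e, e) :=
    (contDiffAt_coordMul hee).fderiv_right (m := 1) (by norm_cast)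
  obtain ⟨K₁, t₁, ht₁, hL₁⟩ := hC.exists_lipschitzOnWith
  obtain ⟨K₂, t₂, ht₂, hL₂⟩ := hC'.exists_lipschitzOnWith
  obtain ⟨r, hr, hsub⟩ := Metric.mem_nhds_iff.1
    (inter_mem (inter_mem ht₁ ht₂) (isOpen_coordMulDomain.mem_nhds hee))
  have hmem : ∀ x ∈ Metric.ball e r, ∀ y ∈ Metric.ball e r,
      (x, y) ∈ t₁ ∩ t₂ ∩ coordMulDomain E G := fun x hx y hy =>
    hsub (by rw [← ball_prod_same]; exact ⟨hx, hy⟩)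
  refine ⟨K₁ + K₂, by positivity, r, hr, fun x hx y hy => (hmem x hx y hy).2, ?_⟩
  intro x hx y hy a ha b hb
  have her : e ∈ Metric.ball e r := Metric.mem_ball_self hr
  have hdiff : ∀ z ∈ Metric.ball e r, HasFDerivWithinAt (fun z => coordMul E G (z, a) - z)
      ((fderiv ℝ (coordMul E G) (z, a)).comp ((ContinuousLinearMap.id ℝ E).prod 0) -
        ContinuousLinearMap.id ℝ E) (Metric.ball e r) z := fun z hz => by
    have hd : HasFDerivAt (coordMul E G) (fderiv ℝ (coordMul E G) (z, a)) (z, a) :=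
      ((contDiffAt_coordMul (hmem z hz a ha).2).differentiableAt (by simp)).hasFDerivAt
    exact ((hd.comp (f := fun x => (id x, a)) z ((hasFDerivAt_id z).prodMk
      (hasFDerivAt_const a z))).sub (hasFDerivAt_id z)).hasFDerivWithinAt
  have hbound : ∀ z ∈ Metric.ball e r,
      ‖(fderiv ℝ (coordMul E G) (z, a)).comp ((ContinuousLinearMap.id ℝ E).prod 0) -
        ContinuousLinearMap.id ℝ E‖ ≤ K₂ * ‖a - e‖ := fun z hz => by
    refine ContinuousLinearMap.opNorm_le_bound _ (by positivity) fun u => ?_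
    have h1 := hL₂.norm_sub_le (hmem z hz a ha).1.2 (hmem z hz e her).1.2
    have h2 : ‖(z, a) - (z, e)‖ = ‖a - e‖ := by simp [Prod.norm_def]
    have h0 := fderiv_coordMul_left (G := G) (hmem z hz e her).2.1 u
    rw [← he] at h0
    have h3 : (((fderiv ℝ (coordMul E G) (z, a)).comp ((ContinuousLinearMap.id ℝ E).prod 0) -
        ContinuousLinearMap.id ℝ E) u) =
        (fderiv ℝ (coordMul E G) (z, a) - fderiv ℝ (coordMul E G) (z, e)) (u, 0) := by
      simp [h0]
    rw [h3]
    refine (ContinuousLinearMap.le_opNorm _ _).trans ?_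
    have h4 : ‖(u, (0 : E))‖ = ‖u‖ := by simp [Prod.norm_def]
    rw [h4]
    gcongr
    rwa [h2] at h1
  have h1 := (convex_ball e r).norm_image_sub_le_of_norm_hasFDerivWithin_le hdiff hbound hy hx
  have h2 := hL₁.norm_sub_le (hmem y hy a ha).1.1 (hmem y hy b hb).1.1
  have h3 : ‖(y, a) - (y, b)‖ = ‖a - b‖ := by simp [Prod.norm_def]
  rw [h3] at h2
  have h4 : coordMul E G (x, a) - coordMul E G (y, b) =
      (coordMul E G (x, a) - x - (coordMul E G (y, a) - y)) + (x - y) +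
        (coordMul E G (y, a) - coordMul E G (y, b)) := by abel
  rw [h4]
  refine (norm_add₃_le).trans ?_
  have h5 : 0 ≤ (K₁ : ℝ) * ‖a - e‖ * ‖x - y‖ := by positivity
  have h6 : 0 ≤ (K₂ : ℝ) * ‖a - b‖ := by positivity
  nlinarith

/-- Convergence of the Euler scheme for one-parameter subgroups. -/
lemma exists_tendsto_pow_floor {X : E} {γ : ℝ → G}
    (hγ : IsOneParameterSubgroup (X : GroupLieAlgebra 𝓘(ℝ, E) G) γ) {g : ℕ → G} {c : ℕ → ℝ} (hg : Tendsto g atTop (𝓝 1))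
    (hc : Tendsto c atTop atTop)
    (hX : Tendsto (fun n => c n • (extChartAt 𝓘(ℝ, E) (1 : G) (g n) -
      extChartAt 𝓘(ℝ, E) (1 : G) 1)) atTop (𝓝 X)) :
    ∃ τ : ℝ, 0 < τ ∧ ∀ t ∈ Icc 0 τ, Tendsto (fun n => g n ^ ⌊c n * t⌋₊) atTop (𝓝 (γ t)) := by
  obtain ⟨L, hL, r, hr, hdom, hest⟩ := exists_norm_coordMul_sub_le E G
  set φ := extChartAt 𝓘(ℝ, E) (1 : G) with hφ
  set e := φ 1 with he
  have h0 := hγ.map_zero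
  have hcont : Continuous γ := hγ.contMDiff.continuous
  have hsource : ∀ᶠ h in 𝓝 (1 : G), h ∈ φ.source := extChartAt_source_mem_nhds _
  have hφc : ContinuousAt φ 1 := continuousAt_extChartAt _
  have her : e ∈ Metric.ball e r := Metric.mem_ball_self hr
  have htarget : ∀ x ∈ Metric.ball e r, x ∈ φ.target := fun x hx => (hdom x hx e her).1
  -- a time interval on which the curve stays in a small ball
  have hnear : ∀ᶠ s in 𝓝 (0 : ℝ), γ s ∈ φ.source ∧ φ (γ s) ∈ Metric.ball e (r / 2) := by
    have h1 : ∀ᶠ h in 𝓝 (1 : G), h ∈ φ.source ∧ φ h ∈ Metric.ball e (r / 2) :=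
      hsource.and (hφc (Metric.ball_mem_nhds _ (by positivity)))
    exact hcont.continuousAt.eventually (by rw [h0]; exact h1)
  obtain ⟨ε, hε, hball⟩ := Metric.eventually_nhds_iff_ball.1 hnear
  have hcurve : ∀ s ∈ Icc 0 (ε / 2), γ s ∈ φ.source ∧ φ (γ s) ∈ Metric.ball e (r / 2) :=
    fun s hs => hball s (by rw [Real.ball_eq_Ioo]; exact ⟨by linarith [hs.1], by linarith [hs.2]⟩)
  refine ⟨ε / 2, by positivity, fun t ht => ?_⟩
  -- the two schemes have the same first order term
  have hδ : Tendsto (fun n => (c n)⁻¹) atTop (𝓝 0) := tendsto_inv_atTop_zero.comp hc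
  have hcpos : ∀ᶠ n in atTop, 0 < c n := hc.eventually_gt_atTop 0
  have hY : Tendsto (fun n => c n • (φ (γ ((c n)⁻¹)) - e)) atTop (𝓝 X) := by
    have h1 : Tendsto (fun n => (c n)⁻¹) atTop (𝓝[≠] 0) :=
      tendsto_nhdsWithin_iff.2 ⟨hδ, hcpos.mono fun n hn => by simpa using hn.ne'⟩
    refine (hγ.hasDerivAt.tendsto_slope_zero.comp h1).congr fun n => ?_
    simp only [Function.comp_apply, zero_add, inv_inv, h0, he]
    rfl
  -- Rescaled one-step error of g n against the exact point γ(1 / c n). Both have first-order term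
  -- X, so it tends to 0.
  set η : ℕ → ℝ := fun n => ‖c n • (φ (g n) - φ (γ ((c n)⁻¹)))‖ with hη
  have hη0 : Tendsto η atTop (𝓝 0) := by
    have := (hX.sub hY).norm
    rw [sub_self, norm_zero] at this
    refine this.congr fun n => ?_
    rw [hη, ← smul_sub, sub_sub_sub_cancel_right]
  set M : ℝ := ‖X‖ + 1 with hM
  have hM0 : 0 ≤ M := by positivity
  have hMn : ∀ᶠ n in atTop, ‖c n • (φ (g n) - e)‖ < M :=
    hX.norm.eventually_lt_const (by simp [hM])
  -- Accumulated error up to time t: at most t/δ steps of size δ, each contributing L η δ, amplified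
  -- by at most exp(L M t).
  set B : ℕ → ℝ := fun n => t * Real.exp (L * M * t) * (L * η n) with hB
  have hB0 : Tendsto B atTop (𝓝 0) := by
    have := (hη0.const_mul L).const_mul (t * Real.exp (L * M * t))
    simpa using this
  have hga : ∀ᶠ n in atTop, g n ∈ φ.source ∧ φ (g n) ∈ Metric.ball e r :=
    hg.eventually (hsource.and (hφc (Metric.ball_mem_nhds _ hr)))
  have hgb : ∀ᶠ n in atTop, γ ((c n)⁻¹) ∈ φ.source ∧ φ (γ ((c n)⁻¹)) ∈ Metric.ball e (r / 2) :=
    hδ.eventually hnear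
  have hmain : ∀ᶠ n in atTop, g n ^ ⌊c n * t⌋₊ ∈ φ.source ∧
      ‖φ (g n ^ ⌊c n * t⌋₊) - φ (γ (⌊c n * t⌋₊ * (c n)⁻¹))‖ ≤ B n := by
    filter_upwards [hcpos, hMn, hB0.eventually_lt_const (show (0 : ℝ) < r / 2 by positivity),
      hga, hgb] with n hn hMn hBn hga hgb
    set δ := (c n)⁻¹ with hδdef
    have hδpos : 0 < δ := inv_pos.2 hn
    have hηn : ‖φ (g n) - φ (γ δ)‖ = η n * δ := by
      rw [hη]
      simp only [norm_smul, Real.norm_eq_abs, abs_of_pos hn]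
      rw [mul_right_comm, mul_inv_cancel₀ hn.ne', one_mul]
    have ha : ‖φ (g n) - e‖ ≤ M * δ := by
      rw [norm_smul, Real.norm_eq_abs, abs_of_pos hn] at hMn
      rw [hδdef, ← div_eq_mul_inv, le_div_iff₀ hn]
      linarith
    have hη_nonneg : 0 ≤ η n := norm_nonneg _
    -- Discrete Grönwall. The induction must also keep the powers in the chart: the exact curve
    -- stays within r/2 of e and the error is at most B n < r/2, so the next product lies where the
    -- estimate applies.
    have step : ∀ j : ℕ, j * δ ≤ t → g n ^ j ∈ φ.source ∧
        ‖φ (g n ^ j) - φ (γ (j * δ))‖ ≤ j * (L * η n * δ) * Real.exp (L * M * δ * j) := by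
      intro j
      induction j with
      | zero => intro _; simp [h0, hφ]
      | succ j ih =>
        intro hj
        push_cast at hj
        have hj' : j * δ ≤ t := by nlinarith
        obtain ⟨h1, h2⟩ := ih hj'
        have hs := hcurve (j * δ) ⟨by positivity, hj'.trans ht.2⟩
        have hs' := hcurve ((j + 1) * δ) ⟨by positivity, hj.trans ht.2⟩
        have hle : j * (L * η n * δ) * Real.exp (L * M * δ * j) ≤ B n := by
          have : L * M * δ * j ≤ L * M * t := by
            rw [mul_assoc, mul_comm δ]; gcongr
          calc j * (L * η n * δ) * Real.exp (L * M * δ * j)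
              = (j * δ) * Real.exp (L * M * δ * j) * (L * η n) := by ring
            _ ≤ B n := by rw [hB]; dsimp only; gcongr; exact ht.1
        have hx : φ (g n ^ j) ∈ Metric.ball e r := by
          rw [mem_ball_iff_norm]
          have := mem_ball_iff_norm.1 hs.2
          calc ‖φ (g n ^ j) - e‖ = ‖(φ (g n ^ j) - φ (γ (j * δ))) + (φ (γ (j * δ)) - e)‖ := by
                rw [sub_add_sub_cancel]
            _ ≤ _ := norm_add_le _ _
            _ < r := by linarith
        have hy : φ (γ (j * δ)) ∈ Metric.ball e r := Metric.ball_subset_ball (by linarith) hs.2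
        have hb : φ (γ δ) ∈ Metric.ball e r := Metric.ball_subset_ball (by linarith) hgb.2
        have h3 := hest _ hx _ hy _ hga.2 _ hb
        rw [coordMul_apply h1 hga.1, coordMul_apply hs.1 hgb.1, ← pow_succ, ← hγ.map_add,
          hηn] at h3
        have h4 := (hdom _ hx _ hga.2).2.2
        rw [← hφ, φ.left_inv h1, φ.left_inv hga.1, ← pow_succ] at h4
        refine ⟨h4, ?_⟩
        push_cast
        rw [add_one_mul]
        refine h3.trans ?_
        have h5 : 1 + L * ‖φ (g n) - e‖ ≤ Real.exp (L * M * δ) := by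
          refine le_trans ?_ (Real.add_one_le_exp _)
          have := mul_le_mul_of_nonneg_left ha hL
          linarith
        have h6 : Real.exp (L * M * δ * (j + 1)) =
            Real.exp (L * M * δ) * Real.exp (L * M * δ * j) := by
          rw [← Real.exp_add]; ring_nf
        have h7 : (1 + L * ‖φ (g n) - e‖) * ‖φ (g n ^ j) - φ (γ (j * δ))‖ ≤
            Real.exp (L * M * δ) * (j * (L * η n * δ) * Real.exp (L * M * δ * j)) := by
          gcongr
        have h8 : 1 ≤ Real.exp (L * M * δ * (j + 1)) := Real.one_le_exp (by positivity)
        have h9 : 0 ≤ L * η n * δ := by positivity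
        calc _ ≤ Real.exp (L * M * δ) * (j * (L * η n * δ) * Real.exp (L * M * δ * j)) +
              L * η n * δ * 1 := by linarith
          _ ≤ Real.exp (L * M * δ) * (j * (L * η n * δ) * Real.exp (L * M * δ * j)) +
              L * η n * δ * Real.exp (L * M * δ * (j + 1)) := by gcongr
          _ = _ := by rw [h6]; ring
    have hj : (⌊c n * t⌋₊ : ℝ) * δ ≤ t := by
      have := Nat.floor_le (mul_nonneg hn.le ht.1)
      rw [hδdef, ← div_eq_mul_inv, div_le_iff₀ hn]
      linarith
    obtain ⟨h1, h2⟩ := step _ hj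
    refine ⟨h1, h2.trans ?_⟩
    generalize ⌊c n * t⌋₊ = j at hj
    have : L * M * δ * j ≤ L * M * t := by
      rw [mul_assoc, mul_comm δ]; gcongr
    calc j * (L * η n * δ) * Real.exp (L * M * δ * j)
        = (j * δ) * Real.exp (L * M * δ * j) * (L * η n) := by ring
      _ ≤ B n := by rw [hB]; dsimp only; gcongr; exact ht.1
  have htime : Tendsto (fun n => (⌊c n * t⌋₊ : ℝ) * (c n)⁻¹) atTop (𝓝 t) := by
    have := (tendsto_nat_floor_mul_div_atTop (R := ℝ) ht.1).comp hc
    refine this.congr fun n => ?_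
    simp [div_eq_mul_inv, mul_comm]
  have hγt := hcurve t ht
  have hφt : ContinuousAt φ (γ t) := continuousAt_extChartAt' hγt.1
  have hlim : Tendsto (fun n => φ (g n ^ ⌊c n * t⌋₊)) atTop (𝓝 (φ (γ t))) := by
    have h1 : Tendsto (fun n => φ (γ (⌊c n * t⌋₊ * (c n)⁻¹))) atTop (𝓝 (φ (γ t))) :=
      hφt.tendsto.comp ((hcont.tendsto t).comp htime)
    have h2 : Tendsto (fun n => φ (g n ^ ⌊c n * t⌋₊) - φ (γ (⌊c n * t⌋₊ * (c n)⁻¹))) atTop (𝓝 0) :=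
      squeeze_zero_norm' (hmain.mono fun n hn => hn.2) hB0
    simpa using h2.add h1
  have hsymm : ContinuousAt φ.symm (φ (γ t)) := continuousAt_extChartAt_symm' hγt.1
  have := hsymm.tendsto.comp hlim
  rw [φ.left_inv hγt.1] at this
  refine this.congr' (hmain.mono fun n hn => ?_)
  exact φ.left_inv hn.1

end Euler

/-! ### The tangent space of a closed subgroup -/

section ClosedSubgroup

open Set Filter Topology

variable {E : Type*} [NormedAddCommGroup E] [NormedSpace ℝ E]
  {G : Type*} [TopologicalSpace G] [ChartedSpace E G] [Group G]

lemma IsOneParameterSubgroup.mul_natCast {X : GroupLieAlgebra 𝓘(ℝ, E) G} {γ : ℝ → G}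
    (hγ : IsOneParameterSubgroup X γ) (n : ℕ) (t : ℝ) : γ (n * t) = γ t ^ n := by
  induction n with
  | zero =>
    have := hγ.map_add 0 0
    simpa using this
  | succ n ih => rw [pow_succ, ← ih, ← hγ.map_add]; push_cast; ring_nf

/-- The tangent set at the identity of a subgroup: initial velocities of the one-parameter
subgroups that stay in `H`. -/
def subgroupTangent (E : Type*) [NormedAddCommGroup E] [NormedSpace ℝ E]
    {G : Type*} [TopologicalSpace G] [ChartedSpace E G] [Group G] (H : Subgroup G) : Set E :=
  {X | ∃ γ : ℝ → G, IsOneParameterSubgroup (X : GroupLieAlgebra 𝓘(ℝ, E) G) γ ∧ ∀ t, γ t ∈ H}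

variable [LieGroup 𝓘(ℝ, E) ∞ G]

-- A time t ≥ 0 is an integer multiple of a time in [0, τ], so γ(t) is a power of an element of H;
-- negative times give inverses.
omit [LieGroup 𝓘(ℝ, E) ∞ G] in
lemma IsOneParameterSubgroup.mem_of_forall_mem_Icc {X : GroupLieAlgebra 𝓘(ℝ, E) G} {γ : ℝ → G}
    (hγ : IsOneParameterSubgroup X γ) (H : Subgroup G) {τ : ℝ} (hτ : 0 < τ)
    (h : ∀ t ∈ Icc 0 τ, γ t ∈ H) (t : ℝ) : γ t ∈ H := by
  have hpos : ∀ t : ℝ, 0 ≤ t → γ t ∈ H := by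
    intro t ht
    obtain ⟨n, hn⟩ := exists_nat_ge (t / τ)
    have hn1 : (0 : ℝ) < n + 1 := by positivity
    have h1 : γ (t / (n + 1)) ∈ H := h _ ⟨by positivity, by
      rw [div_le_iff₀ hn1]; rw [div_le_iff₀ hτ] at hn; nlinarith⟩
    have h2 := H.pow_mem h1 (n + 1)
    rw [← hγ.mul_natCast] at h2
    push_cast at h2
    rwa [mul_div_cancel₀ _ hn1.ne'] at h2
  rcases le_total 0 t with ht | ht
  · exact hpos t ht
  · have h1 := hγ.map_add t (-t)
    rw [add_neg_cancel, hγ.map_zero] at h1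
    rw [eq_inv_of_mul_eq_one_left h1.symm]
    exact H.inv_mem (hpos _ (by linarith))

/-- Closedness of H enters here: powers of g n lie in H, hence so do their limits γ(t) for small t ≥
0. -/
lemma IsOneParameterSubgroup.mem_of_tendsto {X : E} {γ : ℝ → G}
    (hγ : IsOneParameterSubgroup (X : GroupLieAlgebra 𝓘(ℝ, E) G) γ) {H : Subgroup G}
    (hH : IsClosed (H : Set G)) {g : ℕ → G} {c : ℕ → ℝ} (hgH : ∀ n, g n ∈ H)
    (hg : Tendsto g atTop (𝓝 1)) (hc : Tendsto c atTop atTop)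
    (hX : Tendsto (fun n => c n • (extChartAt 𝓘(ℝ, E) (1 : G) (g n) -
      extChartAt 𝓘(ℝ, E) (1 : G) 1)) atTop (𝓝 X)) (t : ℝ) : γ t ∈ H := by
  obtain ⟨τ, hτ, h⟩ := exists_tendsto_pow_floor hγ hg hc hX
  exact hγ.mem_of_forall_mem_Icc H hτ (fun t ht => hH.mem_of_tendsto (h t ht)
    (Eventually.of_forall fun n => H.pow_mem (hgH n) _)) t

lemma hasFDerivAt_extChartAt_mul {F : Type*} [NormedAddCommGroup F] [NormedSpace ℝ F]
    {f₁ f₂ : F → G} {x : F} {D₁ D₂ : F →L[ℝ] E} (h₁ : f₁ x = 1) (h₂ : f₂ x = 1)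
    (hc₁ : ContinuousAt f₁ x) (hc₂ : ContinuousAt f₂ x)
    (hd₁ : HasFDerivAt (extChartAt 𝓘(ℝ, E) (1 : G) ∘ f₁) D₁ x)
    (hd₂ : HasFDerivAt (extChartAt 𝓘(ℝ, E) (1 : G) ∘ f₂) D₂ x) :
    HasFDerivAt (extChartAt 𝓘(ℝ, E) (1 : G) ∘ fun y => f₁ y * f₂ y) (D₁ + D₂) x := by
  have hs : ∀ᶠ h in 𝓝 (1 : G), h ∈ (extChartAt 𝓘(ℝ, E) (1 : G)).source :=
    extChartAt_source_mem_nhds _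
  have hd : HasFDerivAt (coordMul E G) (fderiv ℝ (coordMul E G)
      (extChartAt 𝓘(ℝ, E) (1 : G) 1, extChartAt 𝓘(ℝ, E) (1 : G) 1))
      (extChartAt 𝓘(ℝ, E) (1 : G) 1, extChartAt 𝓘(ℝ, E) (1 : G) 1) :=
    ((contDiffAt_coordMul (mem_coordMulDomain_left
      (mem_extChartAt_target _))).differentiableAt (by simp)).hasFDerivAt
  have hd' : HasFDerivAt (coordMul E G) (fderiv ℝ (coordMul E G)
      (extChartAt 𝓘(ℝ, E) (1 : G) 1, extChartAt 𝓘(ℝ, E) (1 : G) 1))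
      ((extChartAt 𝓘(ℝ, E) (1 : G) ∘ f₁) x, (extChartAt 𝓘(ℝ, E) (1 : G) ∘ f₂) x) := by
    simpa only [Function.comp_apply, h₁, h₂] using hd
  have h3 := hd'.comp x (hd₁.prodMk hd₂)
  refine (h3.congr_of_eventuallyEq ?_).congr_fderiv ?_
  · filter_upwards [hc₁.eventually (by rwa [h₁]), hc₂.eventually (by rwa [h₂])] with y hy₁ hy₂
    exact (coordMul_apply hy₁ hy₂).symm
  · ext v
    exact fderiv_coordMul_one _ _

lemma hasDerivAt_extChartAt_mul {f₁ f₂ : ℝ → G} {x : ℝ} {D₁ D₂ : E} (h₁ : f₁ x = 1) (h₂ : f₂ x = 1)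
    (hc₁ : ContinuousAt f₁ x) (hc₂ : ContinuousAt f₂ x)
    (hd₁ : HasDerivAt (extChartAt 𝓘(ℝ, E) (1 : G) ∘ f₁) D₁ x)
    (hd₂ : HasDerivAt (extChartAt 𝓘(ℝ, E) (1 : G) ∘ f₂) D₂ x) :
    HasDerivAt (extChartAt 𝓘(ℝ, E) (1 : G) ∘ fun y => f₁ y * f₂ y) (D₁ + D₂) x := by
  have := (hasFDerivAt_extChartAt_mul h₁ h₂ hc₁ hc₂ hd₁.hasFDerivAt hd₂.hasFDerivAt).hasDerivAt
  simpa using this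

variable [CompleteSpace E] [T2Space G]

lemma mem_subgroupTangent_of_tendsto {X : E} {H : Subgroup G}
    (hH : IsClosed (H : Set G)) {g : ℕ → G} {c : ℕ → ℝ} (hgH : ∀ n, g n ∈ H)
    (hg : Tendsto g atTop (𝓝 1)) (hc : Tendsto c atTop atTop)
    (hX : Tendsto (fun n => c n • (extChartAt 𝓘(ℝ, E) (1 : G) (g n) -
      extChartAt 𝓘(ℝ, E) (1 : G) 1)) atTop (𝓝 X)) : X ∈ subgroupTangent E H := by
  obtain ⟨γ, hγ⟩ := exists_isOneParameterSubgroup (G := G) X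
  exact ⟨γ, hγ, hγ.mem_of_tendsto hH hgH hg hc hX⟩

lemma mem_subgroupTangent_iff {H : Subgroup G} {X : GroupLieAlgebra 𝓘(ℝ, E) G} :
    (X : E) ∈ subgroupTangent E H ↔ ∀ t : ℝ, lieExp (t • X) ∈ H := by
  constructor
  · rintro ⟨γ, hγ, h⟩ t
    rw [hγ.lieExp_smul]
    exact h t
  · intro h
    obtain ⟨γ, hγ⟩ := exists_isOneParameterSubgroup (G := G) X
    exact ⟨γ, hγ, fun t => by rw [← hγ.lieExp_smul]; exact h t⟩

/-- The curve γ(s) η(s) lies in H and has velocity X + Y at 0. It need not be a one-parameter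
subgroup, but its values at s = 1/(n+1) form an admissible sequence. -/
lemma add_mem_subgroupTangent {H : Subgroup G} (hH : IsClosed (H : Set G)) {X Y : E}
    (hX : X ∈ subgroupTangent E H) (hY : Y ∈ subgroupTangent E H) :
    X + Y ∈ subgroupTangent E H := by
  obtain ⟨γ, hγ, hγH⟩ := hX
  obtain ⟨η, hη, hηH⟩ := hY
  have : IsTopologicalGroup G := topologicalGroup_of_lieGroup 𝓘(ℝ, E) ∞
  have hc : Continuous fun t => γ t * η t := hγ.contMDiff.continuous.mul hη.contMDiff.continuous
  have hd := hasDerivAt_extChartAt_mul hγ.map_zero hη.map_zero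
    hγ.contMDiff.continuous.continuousAt hη.contMDiff.continuous.continuousAt
    hγ.hasDerivAt hη.hasDerivAt
  have hlim : Tendsto (fun n : ℕ => ((n : ℝ) + 1)) atTop atTop :=
    tendsto_atTop_add_const_right _ _ tendsto_natCast_atTop_atTop
  have hinv : Tendsto (fun n : ℕ => ((n : ℝ) + 1)⁻¹) atTop (𝓝 0) :=
    tendsto_inv_atTop_zero.comp hlim
  refine mem_subgroupTangent_of_tendsto hH
    (g := fun n => γ ((n + 1 : ℝ)⁻¹) * η ((n + 1 : ℝ)⁻¹)) (c := fun n => (n : ℝ) + 1)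
    (fun n => H.mul_mem (hγH _) (hηH _)) ?_ hlim ?_
  · have := (hc.tendsto 0).comp hinv
    rwa [hγ.map_zero, hη.map_zero, mul_one] at this
  · have h1 : Tendsto (fun n : ℕ => ((n : ℝ) + 1)⁻¹) atTop (𝓝[≠] 0) :=
      tendsto_nhdsWithin_iff.2 ⟨hinv, Eventually.of_forall fun n => by
        simp only [mem_compl_iff, mem_singleton_iff]; positivity⟩
    refine (hd.tendsto_slope_zero.comp h1).congr fun n => ?_
    simp only [Function.comp_apply, zero_add, inv_inv, hγ.map_zero, hη.map_zero, mul_one]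

/-- The tangent space at the identity of a closed subgroup, as a linear subspace. -/
def tangentSubmodule (H : Subgroup G) (hH : IsClosed (H : Set G)) : Submodule ℝ E where
  carrier := subgroupTangent E H
  add_mem' := add_mem_subgroupTangent hH
  zero_mem' := by
    refine ⟨fun _ => 1, isOneParameterSubgroup_of_hasDerivAt rfl (by simp) continuous_const ?_,
      fun _ => H.one_mem⟩
    exact hasDerivAt_const _ _
  smul_mem' := by
    rintro a X ⟨γ, hγ, h⟩
    exact ⟨_, hγ.comp_mul a, fun t => h _⟩

end ClosedSubgroup

/-! ### A smooth form of the inverse function theorem -/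

section LocalDiffeo

open Set Filter Topology

/-- The inverse function theorem for a map that is smooth on an open set, with a smooth inverse
on the whole target. -/
lemma exists_openPartialHomeomorph_of_contDiffOn {V E : Type*} [NormedAddCommGroup V]
    [NormedSpace ℝ V] [CompleteSpace V] [NormedAddCommGroup E] [NormedSpace ℝ E] {f : V → E}
    {W : Set V} (hW : IsOpen W) (hf : ContDiffOn ℝ ∞ f W) {x : V} (hx : x ∈ W) {A : V ≃L[ℝ] E}
    (hA : HasFDerivAt f (A : V →L[ℝ] E) x) :
    ∃ Θ : OpenPartialHomeomorph V E, x ∈ Θ.source ∧ Θ.source ⊆ W ∧ (∀ y, Θ y = f y) ∧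
      ContDiffOn ℝ ∞ Θ.symm Θ.target := by
  have hfx : ContDiffAt ℝ ∞ f x := hf.contDiffAt (hW.mem_nhds hx)
  have hstrict : HasStrictFDerivAt f (A : V →L[ℝ] E) x := hfx.hasStrictFDerivAt' hA (by simp)
  set Θ₀ := hstrict.toOpenPartialHomeomorph f with hΘ₀
  have hcont : ContinuousOn (fderiv ℝ f) W := hf.continuousOn_fderiv_of_isOpen hW (by simp)
  -- Shrinking to the points of W with invertible derivative makes the inverse smooth on the whole
  -- target, not just at the image of x.
  have hU : IsOpen (W ∩ fderiv ℝ f ⁻¹' range ((↑) : (V ≃L[ℝ] E) → V →L[ℝ] E)) :=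
    hcont.isOpen_inter_preimage hW ContinuousLinearEquiv.isOpen
  refine ⟨Θ₀.restrOpen _ hU, ?_, ?_, fun y => rfl, ?_⟩
  · rw [OpenPartialHomeomorph.restrOpen_source]
    exact ⟨hstrict.mem_toOpenPartialHomeomorph_source, hx, A, hA.fderiv.symm⟩
  · rw [OpenPartialHomeomorph.restrOpen_source]
    exact fun y hy => hy.2.1
  · intro y hy
    set Θ := Θ₀.restrOpen _ hU
    have hs : Θ.symm y ∈ Θ.source := Θ.map_target hy
    rw [OpenPartialHomeomorph.restrOpen_source] at hs
    obtain ⟨-, hsW, B, hB⟩ := hs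
    have hsm : ContDiffAt ℝ ∞ f (Θ.symm y) := hf.contDiffAt (hW.mem_nhds hsW)
    refine (Θ.contDiffAt_symm (f₀' := B) hy ?_ hsm).contDiffWithinAt
    rw [hB]
    exact (hsm.differentiableAt (by simp)).hasFDerivAt

end LocalDiffeo

/-! ### A slice chart at the identity -/

section Slice

open Set Filter Topology

variable {E : Type*} [NormedAddCommGroup E] [NormedSpace ℝ E]
  {G : Type*} [TopologicalSpace G] [ChartedSpace E G] [Group G]
  [LieGroup 𝓘(ℝ, E) ∞ G]

/-- Canonical coordinates of the second kind: products of one-parameter subgroups. -/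
lemma exists_contMDiff_prod_oneParameterSubgroup {ι : Type*} [Fintype ι] [DecidableEq ι]
    {H : Subgroup G} (b : ι → E) (hb : ∀ i, b i ∈ subgroupTangent E H) (s : Finset ι) :
    ∃ σ : EuclideanSpace ℝ ι → G, ContMDiff 𝓘(ℝ, EuclideanSpace ℝ ι) 𝓘(ℝ, E) ∞ σ ∧ σ 0 = 1 ∧
      (∀ t, σ t ∈ H) ∧ HasFDerivAt (extChartAt 𝓘(ℝ, E) (1 : G) ∘ σ)
        (∑ i ∈ s, (EuclideanSpace.proj i : EuclideanSpace ℝ ι →L[ℝ] ℝ).smulRight (b i)) 0 := by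
  induction s using Finset.induction_on with
  | empty =>
    refine ⟨fun _ => 1, contMDiff_const, rfl, fun _ => H.one_mem, ?_⟩
    rw [Finset.sum_empty]
    exact hasFDerivAt_const (extChartAt 𝓘(ℝ, E) (1 : G) 1) (0 : EuclideanSpace ℝ ι)
  | insert i s hi ih =>
    obtain ⟨σ, hσ, h0, hσH, hσd⟩ := ih
    obtain ⟨γ, hγ, hγH⟩ := hb i
    have hproj : ContMDiff 𝓘(ℝ, EuclideanSpace ℝ ι) 𝓘(ℝ, ℝ) ∞
        (EuclideanSpace.proj i : EuclideanSpace ℝ ι →L[ℝ] ℝ) :=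
      (EuclideanSpace.proj i : EuclideanSpace ℝ ι →L[ℝ] ℝ).contDiff.contMDiff
    have hγp : ContMDiff 𝓘(ℝ, EuclideanSpace ℝ ι) 𝓘(ℝ, E) ∞
        (γ ∘ (EuclideanSpace.proj i : EuclideanSpace ℝ ι →L[ℝ] ℝ)) := hγ.contMDiff.comp hproj
    have hγ0 : (γ ∘ (EuclideanSpace.proj i : EuclideanSpace ℝ ι →L[ℝ] ℝ)) 0 = 1 := by
      simp [hγ.map_zero]
    refine ⟨fun t => (γ ∘ (EuclideanSpace.proj i : EuclideanSpace ℝ ι →L[ℝ] ℝ)) t * σ t,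
      hγp.mul hσ, by simpa [h0] using hγ0, fun t => H.mul_mem (hγH _) (hσH t), ?_⟩
    rw [Finset.sum_insert hi]
    refine hasFDerivAt_extChartAt_mul hγ0 h0 hγp.continuous.continuousAt hσ.continuous.continuousAt
      ?_ hσd
    have h1 : HasDerivAt (extChartAt 𝓘(ℝ, E) (1 : G) ∘ γ) (b i)
        ((EuclideanSpace.proj i : EuclideanSpace ℝ ι →L[ℝ] ℝ) 0) := by
      simpa only [map_zero] using hγ.hasDerivAt
    refine (h1.hasFDerivAt.comp (0 : EuclideanSpace ℝ ι)
      (EuclideanSpace.proj i : EuclideanSpace ℝ ι →L[ℝ] ℝ).hasFDerivAt).congr_fderiv ?_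
    ext t
    simp

variable [FiniteDimensional ℝ E] [T2Space G]

/-- Otherwise nonzero Y n → 0 in C give points of H. By compactness of the sphere a subsequence of Y
n / ‖Y n‖ converges to a unit vector Z in C; the scaling c n = 1 / ‖Y n‖ puts Z in the tangent
space, contradicting disjointness. -/
lemma exists_eq_zero_of_mem_subgroup [CompleteSpace E] {H : Subgroup G} (hH : IsClosed (H : Set G))
    {C : Submodule ℝ E} (hC : Disjoint (tangentSubmodule (E := E) H hH) C) :
    ∃ ε > 0, ∀ Y ∈ C, ‖Y‖ < ε →
      (extChartAt 𝓘(ℝ, E) (1 : G)).symm (extChartAt 𝓘(ℝ, E) (1 : G) 1 + Y) ∈ H → Y = 0 := by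
  set φ := extChartAt 𝓘(ℝ, E) (1 : G) with hφ
  by_contra! hcon
  have hpos : ∀ n : ℕ, (0 : ℝ) < ((n : ℝ) + 1)⁻¹ := fun n => by positivity
  choose Y hYC hYlt hYH hY0 using fun n : ℕ => hcon _ (hpos n)
  have hYlim : Tendsto Y atTop (𝓝 0) := by
    refine squeeze_zero_norm (fun n => (hYlt n).le) ?_
    exact tendsto_inv_atTop_zero.comp
      (tendsto_atTop_add_const_right _ _ tendsto_natCast_atTop_atTop)
  have hsph : ∀ n, ‖Y n‖⁻¹ • Y n ∈ Metric.sphere (0 : E) 1 := fun n => by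
    rw [mem_sphere_zero_iff_norm, norm_smul, norm_inv, norm_norm,
      inv_mul_cancel₀ (norm_ne_zero_iff.2 (hY0 n))]
  obtain ⟨Z, hZ, k, hk, hkZ⟩ := (isCompact_sphere (0 : E) 1).tendsto_subseq hsph
  have hklim : Tendsto (Y ∘ k) atTop (𝓝 0) := hYlim.comp hk.tendsto_atTop
  have hZC : Z ∈ C := C.closed_of_finiteDimensional.mem_of_tendsto hkZ
    (Eventually.of_forall fun n => C.smul_mem _ (hYC _))
  have hadd : Tendsto (fun n => φ 1 + Y (k n)) atTop (𝓝 (φ 1)) := by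
    simpa using hklim.const_add (φ 1)
  have htarget : ∀ᶠ n in atTop, φ 1 + Y (k n) ∈ φ.target :=
    hadd.eventually (extChartAt_target_mem_nhds (I := 𝓘(ℝ, E)) (1 : G))
  have hZH : Z ∈ subgroupTangent E H := by
    refine mem_subgroupTangent_of_tendsto hH (g := fun n => φ.symm (φ 1 + Y (k n)))
      (c := fun n => ‖Y (k n)‖⁻¹) (fun n => hYH _) ?_ ?_ ?_
    · have := (continuousAt_extChartAt_symm (I := 𝓘(ℝ, E)) (1 : G)).tendsto.comp hadd
      rwa [extChartAt_to_inv] at this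
    · refine tendsto_inv_nhdsGT_zero.comp (tendsto_nhdsWithin_iff.2 ⟨?_, ?_⟩)
      · simpa using hklim.norm
      · exact Eventually.of_forall fun n => norm_pos_iff.2 (hY0 _)
    · refine hkZ.congr' (htarget.mono fun n hn => ?_)
      simp only [Function.comp_apply]
      rw [φ.right_inv hn, add_sub_cancel_left]
  have : Z = 0 := (Submodule.disjoint_def.1 hC) Z hZH hZC
  rw [this, mem_sphere_zero_iff_norm, norm_zero] at hZ
  exact zero_ne_one hZ

/-- A closed subgroup is a slice in a suitable chart of the group at the identity. -/
lemma exists_slice_chart_one {H : Subgroup G} (hH : IsClosed (H : Set G)) :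
    ∃ (k : ℕ) (C : Submodule ℝ E) (A : (EuclideanSpace ℝ (Fin k) × C) ≃L[ℝ] E)
      (ψ : OpenPartialHomeomorph G E), ψ ∈ IsManifold.maximalAtlas 𝓘(ℝ, E) ∞ G ∧ 1 ∈ ψ.source ∧
      ∀ g ∈ ψ.source, g ∈ H ↔ (A.symm (ψ g)).2 = 0 := by
  have : CompleteSpace E := FiniteDimensional.complete ℝ E
  set φ := extChartAt 𝓘(ℝ, E) (1 : G) with hφ
  obtain ⟨C, hC⟩ := (tangentSubmodule (E := E) H hH).exists_isCompl
  let b := Module.finBasis ℝ (tangentSubmodule (E := E) H hH)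
  set k := Module.finrank ℝ (tangentSubmodule (E := E) H hH)
  let A₀ : (EuclideanSpace ℝ (Fin k) × C) ≃ₗ[ℝ] E :=
    ((((WithLp.linearEquiv 2 ℝ (Fin k → ℝ)).trans b.equivFun.symm).prodCongr
      (LinearEquiv.refl ℝ C)).trans (Submodule.prodEquivOfIsCompl _ _ hC))
  let A : (EuclideanSpace ℝ (Fin k) × C) ≃L[ℝ] E := A₀.toContinuousLinearEquiv
  have hA : ∀ p, A p = ∑ i, p.1 i • (b i : E) + p.2 := fun p => by
    simp [A, A₀, Module.Basis.equivFun_symm_apply]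
  obtain ⟨σ, hσ, hσ0, hσH, hσd⟩ := exists_contMDiff_prod_oneParameterSubgroup
    (fun i => (b i : E)) (fun i => (b i).2) Finset.univ
  obtain ⟨ε, hε, hεH⟩ := exists_eq_zero_of_mem_subgroup hH hC.disjoint
  -- The chart expression of σ(t) · φ⁻¹(φ(1) + Y); its derivative at 0 is the linear isomorphism
  -- `A`.
  let f : EuclideanSpace ℝ (Fin k) × C → E := fun p => coordMul E G (φ (σ p.1), φ 1 + p.2)
  let S : Set (EuclideanSpace ℝ (Fin k) × C) := {p | σ p.1 ∈ φ.source}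
  have hSo : IsOpen S :=
    (isOpen_extChartAt_source (I := 𝓘(ℝ, E)) (1 : G)).preimage (hσ.continuous.comp continuous_fst)
  have hin : ContDiffOn ℝ ∞
      (fun p : EuclideanSpace ℝ (Fin k) × C => (φ (σ p.1), φ 1 + (p.2 : E))) S := by
    refine ContDiffOn.prodMk ?_ ?_
    · rw [← contMDiffOn_iff_contDiffOn]
      refine (contMDiffOn_extChartAt (I := 𝓘(ℝ, E)) (n := ∞) (x := (1 : G))).comp
        (hσ.comp contDiff_fst.contMDiff).contMDiffOn fun p hp => ?_
      simpa [hφ, S] using hp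
    · exact (contDiff_const.add (C.subtypeL.contDiff.comp contDiff_snd)).contDiffOn
  let W : Set (EuclideanSpace ℝ (Fin k) × C) := (S ∩ (fun p : EuclideanSpace ℝ (Fin k) × C =>
    (φ (σ p.1), φ 1 + (p.2 : E))) ⁻¹' coordMulDomain E G) ∩ {p | ‖p.2‖ < ε}
  have hWo : IsOpen W := (hin.continuousOn.isOpen_inter_preimage hSo isOpen_coordMulDomain).inter
    (isOpen_lt (continuous_norm.comp continuous_snd) continuous_const)
  have hf : ContDiffOn ℝ ∞ f W := contDiffOn_coordMul.comp
    (hin.mono fun p hp => hp.1.1) fun p hp => hp.1.2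
  have hm : (φ 1, φ 1) ∈ coordMulDomain E G := mem_coordMulDomain_left (mem_extChartAt_target _)
  have h0W : (0 : EuclideanSpace ℝ (Fin k) × C) ∈ W := by
    refine ⟨⟨?_, ?_⟩, ?_⟩
    · simp [S, hσ0, hφ]
    · simpa [hσ0] using hm
    · simpa using hε
  have hfd : HasFDerivAt f (A : EuclideanSpace ℝ (Fin k) × C →L[ℝ] E) 0 := by
    have hd : HasFDerivAt (coordMul E G) (fderiv ℝ (coordMul E G) (φ 1, φ 1)) (φ 1, φ 1) :=
      ((contDiffAt_coordMul (mem_coordMulDomain_left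
        (mem_extChartAt_target _))).differentiableAt (by simp)).hasFDerivAt
    have h1 : HasFDerivAt (fun p : EuclideanSpace ℝ (Fin k) × C => (φ ∘ σ) p.1) _ 0 :=
      HasFDerivAt.comp (0 : EuclideanSpace ℝ (Fin k) × C) (f := Prod.fst) hσd hasFDerivAt_fst
    have h2 : HasFDerivAt (fun p : EuclideanSpace ℝ (Fin k) × C => φ 1 + (p.2 : E))
        (C.subtypeL.comp (ContinuousLinearMap.snd ℝ _ _)) 0 :=
      ((C.subtypeL.comp (ContinuousLinearMap.snd ℝ (EuclideanSpace ℝ (Fin k)) C)).hasFDerivAt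
        (x := 0)).const_add (φ 1)
    have h3 := HasFDerivAt.comp (0 : EuclideanSpace ℝ (Fin k) × C) (g := coordMul E G)
      (f := fun p => ((φ ∘ σ) p.1, φ 1 + (p.2 : E)))
      (g' := fderiv ℝ (coordMul E G) (φ 1, φ 1)) (by simpa [hσ0] using hd) (h1.prodMk h2)
    refine h3.congr_fderiv ?_
    refine ContinuousLinearMap.ext fun p => ?_
    refine (fderiv_coordMul_one _ _).trans ?_
    simp [hA]
  obtain ⟨Θ, h0Θ, hΘW, hΘf, hΘs⟩ := exists_openPartialHomeomorph_of_contDiffOn hWo hf h0W hfd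
  have hφ1 : ∀ g, chartAt E (1 : G) g = φ g := fun g => rfl
  have hsrc : (chartAt E (1 : G)).source = φ.source := by simp [hφ]
  have hf0 : f 0 = φ 1 := by
    have : coordMul E G (φ 1, φ 1) = φ 1 := coordMul_left (mem_extChartAt_target _)
    simpa [f, hσ0] using this
  let ψ : OpenPartialHomeomorph G E :=
    (chartAt E (1 : G)).trans (Θ.symm.trans A.toHomeomorph.toOpenPartialHomeomorph)
  refine ⟨k, C, A, ψ, ?_, ?_, ?_⟩
  · refine OpenPartialHomeomorph.mem_maximalAtlas_of_contMDiffOn ψ ?_ ?_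
    · have h1 : ContMDiffOn 𝓘(ℝ, E) 𝓘(ℝ, E) ∞ (chartAt E (1 : G)) (chartAt E (1 : G)).source :=
        contMDiffOn_chart
      have h2 : ContMDiffOn 𝓘(ℝ, E) 𝓘(ℝ, E) ∞ (fun x => A (Θ.symm x)) Θ.target :=
        (A.contDiff.comp_contDiffOn hΘs).contMDiffOn
      refine (h2.comp (h1.mono (t := ψ.source) fun g hg => ?_) fun g hg => ?_)
      · exact hg.1
      · have := hg.2
        simp at this
        exact this
    · have h1 : ContMDiffOn 𝓘(ℝ, E) 𝓘(ℝ, E) ∞ (chartAt E (1 : G)).symm (chartAt E (1 : G)).target :=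
        contMDiffOn_chart_symm
      have h2 : ContMDiffOn 𝓘(ℝ, E) 𝓘(ℝ, E) ∞ (fun x => f (A.symm x)) (A.symm ⁻¹' W) :=
        (hf.comp A.symm.contDiff.contDiffOn fun x hx => hx).contMDiffOn
      have hmem : ∀ x ∈ ψ.target, A.symm x ∈ Θ.source ∧ f (A.symm x) ∈ (chartAt E (1 : G)).target := by
        intro x hx
        have := hx
        simp only [ψ, OpenPartialHomeomorph.trans_target, mem_inter_iff, mem_preimage] at this
        refine ⟨this.1.2, ?_⟩
        rw [← hΘf]
        exact this.2
      refine ((h1.comp (h2.mono (t := ψ.target) fun x hx => hΘW (hmem x hx).1)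
        fun x hx => (hmem x hx).2)).congr fun x hx => ?_
      change (chartAt E (1 : G)).symm (Θ (A.symm x)) = (chartAt E (1 : G)).symm (f (A.symm x))
      rw [hΘf]
  · refine ⟨mem_chart_source E (1 : G), ?_⟩
    refine ⟨?_, mem_univ _⟩
    change φ 1 ∈ Θ.target
    rw [← hf0, ← hΘf]
    exact Θ.map_source h0Θ
  · intro g hg
    have hg1 : g ∈ φ.source := hsrc ▸ hg.1
    have hg2 : φ g ∈ Θ.target := hg.2.1
    have hψ : A.symm (ψ g) = Θ.symm (φ g) := A.symm_apply_apply _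
    rw [hψ]
    set p := Θ.symm (φ g) with hp
    have hpW : p ∈ W := hΘW (Θ.map_target hg2)
    have hfp : f p = φ g := by rw [← hΘf]; exact Θ.right_inv hg2
    have hgp : g = σ p.1 * φ.symm (φ 1 + p.2) := by
      have h1 : φ (φ.symm (φ (σ p.1)) * φ.symm (φ 1 + p.2)) = φ g := hfp
      have h2 := hpW.1.2.2.2
      rw [φ.left_inv hpW.1.1] at h1
      change φ.symm (φ (σ p.1)) * φ.symm (φ 1 + p.2) ∈ φ.source at h2
      rw [φ.left_inv hpW.1.1] at h2
      exact (φ.injOn h2 hg1 h1).symm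
    -- The factor σ(t) lies in H and cancels, leaving the condition on Y alone.
    rw [hgp, Subgroup.mul_mem_cancel_left H (hσH p.1)]
    constructor
    · intro h
      exact Subtype.ext (hεH p.2 p.2.2 hpW.2 h)
    · intro h
      rw [h]
      simp [hφ, H.one_mem]

end Slice

/-! ### Manifold structure on a subset that is locally a slice -/

section Submanifold

open Set Filter Topology

variable {E V C : Type*} [NormedAddCommGroup E] [NormedSpace ℝ E] [NormedAddCommGroup V]
  [NormedSpace ℝ V] [NormedAddCommGroup C] [NormedSpace ℝ C]
  {M : Type*} [TopologicalSpace M] [ChartedSpace E M]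

open Classical in
/-- The chart of a subset `S` induced by a chart `ψ` of the ambient manifold in which `S` is the
slice `V × {0}`. -/
noncomputable def sliceChart (A : (V × C) ≃L[ℝ] E) {S : Set M} (ψ : OpenPartialHomeomorph M E)
    (hψ : ∀ g ∈ ψ.source, g ∈ S ↔ (A.symm (ψ g)).2 = 0) (x₀ : S) : OpenPartialHomeomorph S V where
  toFun x := (A.symm (ψ x)).1
  -- On the target, A (u, 0) has zero C-component, so its preimage under ψ lies in S. Elsewhere x₀
  -- is a junk value.
  invFun u := if hu : A (u, 0) ∈ ψ.target then
    ⟨ψ.symm (A (u, 0)), (hψ _ (ψ.map_target hu)).2 (by simp [ψ.right_inv hu])⟩ else x₀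
  source := Subtype.val ⁻¹' ψ.source
  target := {u | A (u, 0) ∈ ψ.target}
  map_source' x hx := by
    have h0 := (hψ x hx).1 x.2
    have h1 : ((A.symm (ψ x)).1, (0 : C)) = A.symm (ψ x) := Prod.ext rfl h0.symm
    simp [h1, ψ.map_source hx]
  map_target' u hu := by
    have hu' : A (u, 0) ∈ ψ.target := hu
    simp [hu', ψ.map_target hu']
  left_inv' x hx := by
    have h0 := (hψ x hx).1 x.2
    have h1 : ((A.symm (ψ x)).1, (0 : C)) = A.symm (ψ x) := Prod.ext rfl h0.symm
    have h2 := ψ.map_source hx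
    simp only [h1, ContinuousLinearEquiv.apply_symm_apply, h2, dite_true]
    exact Subtype.ext (ψ.left_inv hx)
  right_inv' u hu := by
    have hu' : A (u, 0) ∈ ψ.target := hu
    simp [hu', ψ.right_inv hu']
  open_source := ψ.open_source.preimage continuous_subtype_val
  open_target := ψ.open_target.preimage (A.continuous.comp (by fun_prop))
  continuousOn_toFun := continuous_fst.comp_continuousOn (A.symm.continuous.comp_continuousOn
    (ψ.continuousOn.comp continuous_subtype_val.continuousOn fun x hx => hx))
  continuousOn_invFun := by
    rw [IsInducing.subtypeVal.continuousOn_iff]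
    have h1 : ContinuousOn (fun u => ψ.symm (A (u, 0))) {u : V | A (u, (0 : C)) ∈ ψ.target} :=
      ψ.continuousOn_symm.comp (A.continuous.comp (by fun_prop)).continuousOn fun u hu => hu
    refine h1.congr fun u hu => ?_
    have hu' : A (u, 0) ∈ ψ.target := hu
    simp [hu']

variable {A : (V × C) ≃L[ℝ] E} {S : Set M} {ψ : OpenPartialHomeomorph M E}
    {hψ : ∀ g ∈ ψ.source, g ∈ S ↔ (A.symm (ψ g)).2 = 0} {x₀ : S}

omit [ChartedSpace E M] in
lemma coe_sliceChart_symm {u : V} (hu : u ∈ (sliceChart A ψ hψ x₀).target) :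
    ((sliceChart A ψ hψ x₀).symm u : M) = ψ.symm (A (u, 0)) := by
  have hu' : A (u, 0) ∈ ψ.target := hu
  simp [sliceChart, hu']

/-- The charted space structure on a subset that is a slice in suitable charts. -/
@[reducible] noncomputable def sliceChartedSpace (A : (V × C) ≃L[ℝ] E) {S : Set M}
    (ψ : S → OpenPartialHomeomorph M E)
    (hψ : ∀ x, ∀ g ∈ (ψ x).source, g ∈ S ↔ (A.symm (ψ x g)).2 = 0)
    (hmem : ∀ x : S, (x : M) ∈ (ψ x).source) : ChartedSpace V S where
  atlas := range fun x => sliceChart A (ψ x) (hψ x) x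
  chartAt x := sliceChart A (ψ x) (hψ x) x
  mem_chart_source x := hmem x
  chart_mem_atlas x := mem_range_self x

/-- The transition map is an ambient smooth transition composed with the inclusion u ↦ (u, 0) and
the projection to V. -/
lemma contDiffOn_sliceChart_trans {ψ₁ ψ₂ : OpenPartialHomeomorph M E}
    {hψ₁ : ∀ g ∈ ψ₁.source, g ∈ S ↔ (A.symm (ψ₁ g)).2 = 0}
    {hψ₂ : ∀ g ∈ ψ₂.source, g ∈ S ↔ (A.symm (ψ₂ g)).2 = 0}
    (h₁ : ψ₁ ∈ IsManifold.maximalAtlas 𝓘(ℝ, E) ∞ M) (h₂ : ψ₂ ∈ IsManifold.maximalAtlas 𝓘(ℝ, E) ∞ M)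
    {x₁ x₂ : S} :
    ContDiffOn ℝ ∞ ((sliceChart A ψ₁ hψ₁ x₁).symm.trans (sliceChart A ψ₂ hψ₂ x₂))
      ((sliceChart A ψ₁ hψ₁ x₁).symm.trans (sliceChart A ψ₂ hψ₂ x₂)).source := by
  set s := ((sliceChart A ψ₁ hψ₁ x₁).symm.trans (sliceChart A ψ₂ hψ₂ x₂)).source with hs
  have hmem : ∀ u ∈ s, u ∈ (sliceChart A ψ₁ hψ₁ x₁).target ∧ ψ₁.symm (A (u, 0)) ∈ ψ₂.source := by
    intro u hu
    have hu1 : u ∈ (sliceChart A ψ₁ hψ₁ x₁).target := hu.1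
    refine ⟨hu1, ?_⟩
    rw [← coe_sliceChart_symm hu1]
    exact hu.2
  have e1 : ContMDiffOn 𝓘(ℝ, V) 𝓘(ℝ, E) ∞ (fun u : V => A (u, 0)) s :=
    (A.contDiff.comp (by fun_prop : ContDiff ℝ ∞ fun u : V => (u, (0 : C)))).contMDiff.contMDiffOn
  have e2 : ContMDiffOn 𝓘(ℝ, V) 𝓘(ℝ, E) ∞ (fun u : V => ψ₁.symm (A (u, 0))) s :=
    (contMDiffOn_symm_of_mem_maximalAtlas h₁).comp e1 fun u hu => (hmem u hu).1
  have e3 : ContMDiffOn 𝓘(ℝ, V) 𝓘(ℝ, E) ∞ (fun u : V => ψ₂ (ψ₁.symm (A (u, 0)))) s :=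
    (contMDiffOn_of_mem_maximalAtlas h₂).comp e2 fun u hu => (hmem u hu).2
  have e4 : ContDiffOn ℝ ∞ (fun u : V => (A.symm (ψ₂ (ψ₁.symm (A (u, 0))))).1) s :=
    contDiff_fst.comp_contDiffOn
      (A.symm.contDiff.comp_contDiffOn (contMDiffOn_iff_contDiffOn.1 e3))
  refine e4.congr fun u hu => ?_
  change (A.symm (ψ₂ ((sliceChart A ψ₁ hψ₁ x₁).symm u : M))).1 = _
  rw [coe_sliceChart_symm (hmem u hu).1]

lemma isManifold_sliceChartedSpace (A : (V × C) ≃L[ℝ] E) {S : Set M}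
    (ψ : S → OpenPartialHomeomorph M E)
    (hψ : ∀ x, ∀ g ∈ (ψ x).source, g ∈ S ↔ (A.symm (ψ x g)).2 = 0)
    (hmem : ∀ x : S, (x : M) ∈ (ψ x).source)
    (hmax : ∀ x, ψ x ∈ IsManifold.maximalAtlas 𝓘(ℝ, E) ∞ M) :
    letI := sliceChartedSpace A ψ hψ hmem
    IsManifold 𝓘(ℝ, V) ∞ S := by
  let := sliceChartedSpace A ψ hψ hmem
  refine isManifold_of_contDiffOn _ _ _ ?_
  rintro _ _ ⟨x, rfl⟩ ⟨y, rfl⟩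
  simpa using contDiffOn_sliceChart_trans (hψ₁ := hψ x) (hψ₂ := hψ y) (x₁ := x) (x₂ := y)
    (hmax x) (hmax y)

/-- In a slice chart and its ambient chart the inclusion reads u ↦ A (u, 0), the normal form of an
immersion. -/
lemma isImmersionOfComplement_sliceChartedSpace (A : (V × C) ≃L[ℝ] E) {S : Set M}
    (ψ : S → OpenPartialHomeomorph M E)
    (hψ : ∀ x, ∀ g ∈ (ψ x).source, g ∈ S ↔ (A.symm (ψ x g)).2 = 0)
    (hmem : ∀ x : S, (x : M) ∈ (ψ x).source)
    (hmax : ∀ x, ψ x ∈ IsManifold.maximalAtlas 𝓘(ℝ, E) ∞ M) :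
    letI := sliceChartedSpace A ψ hψ hmem
    Manifold.IsImmersionOfComplement C 𝓘(ℝ, V) 𝓘(ℝ, E) ∞ (Subtype.val : S → M) := by
  let := sliceChartedSpace A ψ hψ hmem
  have := isManifold_sliceChartedSpace A ψ hψ hmem hmax
  intro x
  refine Manifold.IsImmersionAtOfComplement.mk_of_charts A (chartAt V x) (ψ x)
    (mem_chart_source V x) (hmem x) (IsManifold.chart_mem_maximalAtlas x) (hmax x)
    (fun y hy => hy) ?_
  intro u hu
  have hu' : u ∈ (sliceChart A (ψ x) (hψ x) x).target := by
    rw [OpenPartialHomeomorph.extend_target] at hu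
    exact hu.1
  change ψ x ((sliceChart A (ψ x) (hψ x) x).symm u : M) = A (u, 0)
  rw [coe_sliceChart_symm hu', (ψ x).right_inv hu']

end Submanifold

/-! ### A closed subgroup is an embedded Lie subgroup -/

section EmbeddedSubgroup

open Set Filter Topology

variable {E : Type*} [NormedAddCommGroup E] [NormedSpace ℝ E] [FiniteDimensional ℝ E]
  {G : Type*} [TopologicalSpace G] [ChartedSpace E G] [Group G] [LieGroup 𝓘(ℝ, E) ∞ G]

-- A continuous map into H is smooth once its composite with the immersion is. The subspace topology
-- supplies continuity of the operations, and G supplies smoothness.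
omit [FiniteDimensional ℝ E] in
lemma lieGroup_of_isImmersion {V : Type*} [NormedAddCommGroup V] [NormedSpace ℝ V]
    (H : Subgroup G) [ChartedSpace V H] [IsManifold 𝓘(ℝ, V) ∞ H]
    (h : Manifold.IsImmersion 𝓘(ℝ, V) 𝓘(ℝ, E) ∞ (Subtype.val : H → G)) :
    LieGroup 𝓘(ℝ, V) ∞ H := by
  have : IsTopologicalGroup G := topologicalGroup_of_lieGroup 𝓘(ℝ, E) ∞
  refine { contMDiff_mul := ?_, contMDiff_inv := ?_ }
  · refine (ContMDiff.iff_comp_isImmersion h).2 ⟨continuous_mul, ?_⟩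
    exact (h.contMDiff.comp contMDiff_fst).mul (h.contMDiff.comp contMDiff_snd)
  · refine (ContMDiff.iff_comp_isImmersion h).2 ⟨continuous_inv, ?_⟩
    exact h.contMDiff.inv

omit [FiniteDimensional ℝ E] in
lemma mulLeft_trans_mem_maximalAtlas {ψ : OpenPartialHomeomorph G E}
    (hψ : ψ ∈ IsManifold.maximalAtlas 𝓘(ℝ, E) ∞ G) [IsTopologicalGroup G] (g : G) :
    (Homeomorph.mulLeft g).toOpenPartialHomeomorph.trans ψ ∈
      IsManifold.maximalAtlas 𝓘(ℝ, E) ∞ G := by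
  refine OpenPartialHomeomorph.mem_maximalAtlas_of_contMDiffOn _ ?_ ?_
  · refine (contMDiffOn_of_mem_maximalAtlas hψ).comp
      (contMDiff_mul_left (I := 𝓘(ℝ, E)) (a := g)).contMDiffOn fun x hx => hx.2
  · refine (contMDiff_mul_left (I := 𝓘(ℝ, E)) (a := g⁻¹)).comp_contMDiffOn
      ((contMDiffOn_symm_of_mem_maximalAtlas hψ).mono fun x hx => hx.1)

/-- A closed subgroup of a Lie group is an embedded Lie subgroup. -/
theorem exists_isEmbeddedLieSubgroup [T2Space G] (H : Subgroup G) (hH : IsClosed (H : Set G)) :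
    ∃ (k : ℕ) (_ : ChartedSpace (EuclideanSpace ℝ (Fin k)) H), IsEmbeddedLieSubgroup E H k := by
  have : IsTopologicalGroup G := topologicalGroup_of_lieGroup 𝓘(ℝ, E) ∞
  obtain ⟨k, C, A, ψ, hmax, h1, hslice⟩ := exists_slice_chart_one (E := E) hH
  -- Translation by h⁻¹ moves h to 1 and preserves H, so the slice chart at 1 pulls back to one at
  -- h.
  let Ψ : ↥(H : Set G) → OpenPartialHomeomorph G E := fun h =>
    (Homeomorph.mulLeft (h : G)⁻¹).toOpenPartialHomeomorph.trans ψ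
  have hΨmax : ∀ h, Ψ h ∈ IsManifold.maximalAtlas 𝓘(ℝ, E) ∞ G := fun h =>
    mulLeft_trans_mem_maximalAtlas hmax _
  have hΨmem : ∀ h : (H : Set G), (h : G) ∈ (Ψ h).source := fun h => by
    simp [Ψ, h1]
  have hΨ : ∀ h, ∀ g ∈ (Ψ h).source, g ∈ (H : Set G) ↔ (A.symm (Ψ h g)).2 = 0 := by
    intro h g hg
    have h2 : (h : G)⁻¹ * g ∈ ψ.source := hg.2
    exact (Subgroup.mul_mem_cancel_left H (H.inv_mem h.2)).symm.trans (hslice _ h2)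
  let : ChartedSpace (EuclideanSpace ℝ (Fin k)) H := sliceChartedSpace A Ψ hΨ hΨmem
  have : IsManifold (𝓡 k) ∞ H := isManifold_sliceChartedSpace A Ψ hΨ hΨmem hΨmax
  have himm : Manifold.IsImmersion (𝓡 k) 𝓘(ℝ, E) ∞ (Subtype.val : H → G) :=
    (isImmersionOfComplement_sliceChartedSpace A Ψ hΨ hΨmem hΨmax).isImmersion
  exact ⟨k, inferInstance, lieGroup_of_isImmersion H himm, himm, IsEmbedding.subtypeVal⟩

end EmbeddedSubgroup

/-! ### Lie brackets of related vector fields -/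

section RelatedVectorFields

open Set Filter Topology VectorField

lemma two_le_infty : (2 : ℕ∞ω) ≤ ∞ := ENat.LEInfty.out

/-- Differentiate the relations Df(V) = V' ∘ f and Df(W) = W' ∘ f; the second derivatives of f
cancel by symmetry. Hence f need not be locally invertible. -/
lemma fderiv_lieBracket_of_related {E E' : Type*} [NormedAddCommGroup E] [NormedSpace ℝ E]
    [NormedAddCommGroup E'] [NormedSpace ℝ E'] {f : E → E'} {V W : E → E} {V' W' : E' → E'} {x : E}
    (hf : ContDiffAt ℝ ∞ f x) (hV : DifferentiableAt ℝ V x) (hW : DifferentiableAt ℝ W x)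
    (hV' : DifferentiableAt ℝ V' (f x)) (hW' : DifferentiableAt ℝ W' (f x))
    (hVV' : ∀ᶠ y in 𝓝 x, fderiv ℝ f y (V y) = V' (f y))
    (hWW' : ∀ᶠ y in 𝓝 x, fderiv ℝ f y (W y) = W' (f y)) :
    fderiv ℝ f x (lieBracket ℝ V W x) = lieBracket ℝ V' W' (f x) := by
  have hfd : DifferentiableAt ℝ f x := hf.differentiableAt (by simp)
  rw [fderiv_apply_lieBracket hf (by simpa using two_le_infty) hW hV,
    Filter.EventuallyEq.fderiv_eq hVV', Filter.EventuallyEq.fderiv_eq hWW']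
  have h1 : fderiv ℝ (fun y => V' (f y)) x = (fderiv ℝ V' (f x)).comp (fderiv ℝ f x) :=
    fderiv_comp x hV' hfd
  have h2 : fderiv ℝ (fun y => W' (f y)) x = (fderiv ℝ W' (f x)).comp (fderiv ℝ f x) :=
    fderiv_comp x hW' hfd
  rw [h1, h2, lieBracket_eq]
  simp [hVV'.self_of_nhds, hWW'.self_of_nhds]

variable {E : Type*} [NormedAddCommGroup E] [NormedSpace ℝ E]
  {M : Type*} [TopologicalSpace M] [ChartedSpace E M] [IsManifold 𝓘(ℝ, E) ∞ M]

lemma isInvertible_mfderiv_extChartAt_symm {x : M} {u : E}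
    (hu : u ∈ (extChartAt 𝓘(ℝ, E) x).target) :
    (mfderiv 𝓘(ℝ, E) 𝓘(ℝ, E) (extChartAt 𝓘(ℝ, E) x).symm u).IsInvertible := by
  have : IsManifold 𝓘(ℝ, E) 1 M := .of_le (n := ∞) (by simp)
  have := isInvertible_mfderivWithin_extChartAt_symm (I := 𝓘(ℝ, E)) hu
  simpa using this

lemma contMDiffAt_extChartAt_symm {x : M} {u : E} (hu : u ∈ (extChartAt 𝓘(ℝ, E) x).target) :
    ContMDiffAt 𝓘(ℝ, E) 𝓘(ℝ, E) ∞ (extChartAt 𝓘(ℝ, E) x).symm u :=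
  (contMDiffOn_extChartAt_symm x).contMDiffAt ((isOpen_extChartAt_target x).mem_nhds hu)

/-- The derivative of the inverse of the preferred chart at `x`, as a map between model spaces. -/
noncomputable def chartSymmDeriv (x : M) (u : E) : E →L[ℝ] E :=
  mfderiv 𝓘(ℝ, E) 𝓘(ℝ, E) (extChartAt 𝓘(ℝ, E) x).symm u

/-- The expression of a vector field in the preferred chart at `x`. -/
noncomputable def chartField (x : M) (V : ∀ y : M, TangentSpace 𝓘(ℝ, E) y) (u : E) : E :=
  (chartSymmDeriv x u).inverse (V ((extChartAt 𝓘(ℝ, E) x).symm u))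

lemma isInvertible_chartSymmDeriv {x : M} {u : E} (hu : u ∈ (extChartAt 𝓘(ℝ, E) x).target) :
    (chartSymmDeriv x u).IsInvertible :=
  isInvertible_mfderiv_extChartAt_symm hu

lemma chartSymmDeriv_chartField {x : M} {u : E} (hu : u ∈ (extChartAt 𝓘(ℝ, E) x).target)
    (V : ∀ y : M, TangentSpace 𝓘(ℝ, E) y) :
    chartSymmDeriv x u (chartField x V u) = V ((extChartAt 𝓘(ℝ, E) x).symm u) :=
  (isInvertible_chartSymmDeriv hu).self_apply_inverse _

lemma chartSymmDeriv_lieBracket [CompleteSpace E] {V W : ∀ x : M, TangentSpace 𝓘(ℝ, E) x} {x : M}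
    (hV : MDifferentiableAt 𝓘(ℝ, E) (𝓘(ℝ, E).prod 𝓘(ℝ, E))
      (fun y => (⟨y, V y⟩ : TangentBundle 𝓘(ℝ, E) M)) x)
    (hW : MDifferentiableAt 𝓘(ℝ, E) (𝓘(ℝ, E).prod 𝓘(ℝ, E))
      (fun y => (⟨y, W y⟩ : TangentBundle 𝓘(ℝ, E) M)) x) :
    chartSymmDeriv x (extChartAt 𝓘(ℝ, E) x x)
      (lieBracket ℝ (chartField x V) (chartField x W) (extChartAt 𝓘(ℝ, E) x x)) =
      mlieBracket 𝓘(ℝ, E) V W x := by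
  have : IsManifold 𝓘(ℝ, E) (minSmoothness ℝ 2) M :=
    .of_le (n := ∞) (by simpa using two_le_infty)
  have : IsManifold 𝓘(ℝ, E) (minSmoothness ℝ 3) M :=
    .of_le (n := ∞) ENat.LEInfty.out
  have hx : (extChartAt 𝓘(ℝ, E) x).symm (extChartAt 𝓘(ℝ, E) x x) = x := extChartAt_to_inv x
  have h1 := mpullback_mlieBracket (I := 𝓘(ℝ, E)) (I' := 𝓘(ℝ, E)) (n := ∞)
    (f := (extChartAt 𝓘(ℝ, E) x).symm) (x₀ := extChartAt 𝓘(ℝ, E) x x)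
    (V := V) (W := W) (by rwa [hx]) (by rwa [hx])
    (contMDiffAt_extChartAt_symm (mem_extChartAt_target x)) (by simpa using two_le_infty)
  have h2 : ∀ y : M, y = x → (mlieBracket 𝓘(ℝ, E) V W y : E) = mlieBracket 𝓘(ℝ, E) V W x := by
    rintro _ rfl; rfl
  have h3 : mlieBracket 𝓘(ℝ, E) (chartField x V) (chartField x W) (extChartAt 𝓘(ℝ, E) x x) =
      lieBracket ℝ (chartField x V) (chartField x W) (extChartAt 𝓘(ℝ, E) x x) := by
    rw [← lieBracketWithin_univ]
    exact congrFun (mlieBracketWithin_eq_lieBracketWithin (𝕜 := ℝ) (V := chartField x V)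
      (W := chartField x W) (s := univ)) (extChartAt 𝓘(ℝ, E) x x)
  have h4 : chartField x (mlieBracket 𝓘(ℝ, E) V W) (extChartAt 𝓘(ℝ, E) x x) =
      lieBracket ℝ (chartField x V) (chartField x W) (extChartAt 𝓘(ℝ, E) x x) := h1.trans h3
  rw [← h4, chartSymmDeriv_chartField (mem_extChartAt_target x)]
  exact h2 _ hx

lemma differentiableAt_chartField [CompleteSpace E]
    {V : ∀ x : M, TangentSpace 𝓘(ℝ, E) x} {x : M}
    (hV : ContMDiffAt 𝓘(ℝ, E) (𝓘(ℝ, E).prod 𝓘(ℝ, E)) 1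
      (fun y => (⟨y, V y⟩ : TangentBundle 𝓘(ℝ, E) M)) x) :
    DifferentiableAt ℝ (chartField x V) (extChartAt 𝓘(ℝ, E) x x) := by
  have : IsManifold 𝓘(ℝ, E) 1 M := .of_le (n := ∞) (by simp)
  have : IsManifold 𝓘(ℝ, E) 2 M := .of_le (n := ∞) two_le_infty
  have hx : (extChartAt 𝓘(ℝ, E) x).symm (extChartAt 𝓘(ℝ, E) x x) = x := extChartAt_to_inv x
  have h1 := ContMDiffAt.mpullback_vectorField_preimage (I := 𝓘(ℝ, E)) (I' := 𝓘(ℝ, E)) (m := 1)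
    (n := 2) (f := (extChartAt 𝓘(ℝ, E) x).symm) (x₀ := extChartAt 𝓘(ℝ, E) x x) (V := V)
    (by rwa [hx])
    ((contMDiffAt_extChartAt_symm (mem_extChartAt_target x)).of_le two_le_infty)
    (isInvertible_mfderiv_extChartAt_symm (mem_extChartAt_target x)) (by norm_num)
  have h2 : ContDiffAt ℝ 1 (chartField x V) (extChartAt 𝓘(ℝ, E) x x) :=
    contMDiffAt_vectorSpace_iff_contDiffAt.1 h1
  exact h2.differentiableAt one_ne_zero

variable {E' : Type*} [NormedAddCommGroup E'] [NormedSpace ℝ E']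
  {M' : Type*} [TopologicalSpace M'] [ChartedSpace E' M'] [IsManifold 𝓘(ℝ, E') ∞ M']

/-- An inclusion is not invertible, so fields cannot be pulled back along f itself. They are pulled
back along inverse charts on both sides, which reduces the claim to vector spaces. -/
lemma mfderiv_mlieBracket_of_related [CompleteSpace E] [CompleteSpace E'] {f : M → M'} {x : M}
    {V W : ∀ x : M, TangentSpace 𝓘(ℝ, E) x} {V' W' : ∀ x : M', TangentSpace 𝓘(ℝ, E') x}
    (hf : ContMDiff 𝓘(ℝ, E) 𝓘(ℝ, E') ∞ f)
    (hV : ContMDiffAt 𝓘(ℝ, E) (𝓘(ℝ, E).prod 𝓘(ℝ, E)) 1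
      (fun y => (⟨y, V y⟩ : TangentBundle 𝓘(ℝ, E) M)) x)
    (hW : ContMDiffAt 𝓘(ℝ, E) (𝓘(ℝ, E).prod 𝓘(ℝ, E)) 1
      (fun y => (⟨y, W y⟩ : TangentBundle 𝓘(ℝ, E) M)) x)
    (hV' : ContMDiffAt 𝓘(ℝ, E') (𝓘(ℝ, E').prod 𝓘(ℝ, E')) 1
      (fun y => (⟨y, V' y⟩ : TangentBundle 𝓘(ℝ, E') M')) (f x))
    (hW' : ContMDiffAt 𝓘(ℝ, E') (𝓘(ℝ, E').prod 𝓘(ℝ, E')) 1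
      (fun y => (⟨y, W' y⟩ : TangentBundle 𝓘(ℝ, E') M')) (f x))
    (hVV' : ∀ y, mfderiv 𝓘(ℝ, E) 𝓘(ℝ, E') f y (V y) = V' (f y))
    (hWW' : ∀ y, mfderiv 𝓘(ℝ, E) 𝓘(ℝ, E') f y (W y) = W' (f y)) :
    mfderiv 𝓘(ℝ, E) 𝓘(ℝ, E') f x (mlieBracket 𝓘(ℝ, E) V W x) =
      mlieBracket 𝓘(ℝ, E') V' W' (f x) := by
  set φ := extChartAt 𝓘(ℝ, E) x with hφ
  set ψ := extChartAt 𝓘(ℝ, E') (f x) with hψ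
  have hx : φ.symm (φ x) = x := extChartAt_to_inv x
  have : IsManifold 𝓘(ℝ, E) 1 M := .of_le (n := ∞) (by simp)
  have : IsManifold 𝓘(ℝ, E') 1 M' := .of_le (n := ∞) (by simp)
  let g : E → E' := ψ ∘ f ∘ φ.symm
  have hg0 : g (φ x) = ψ (f x) := congrArg (ψ ∘ f) hx
  -- near `φ x` everything stays in the chart domains
  have hcont : ContinuousAt (f ∘ φ.symm) (φ x) :=
    hf.continuous.continuousAt.comp (continuousAt_extChartAt_symm x)
  have hdom : ∀ᶠ u in 𝓝 (φ x), u ∈ φ.target ∧ f (φ.symm u) ∈ ψ.source := by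
    refine (eventually_mem_set.2 (extChartAt_target_mem_nhds x)).and
      (hcont.preimage_mem_nhds ?_)
    simp only [Function.comp_apply, hx]
    exact extChartAt_source_mem_nhds (f x)
  have hgsmooth : ∀ u, u ∈ φ.target ∧ f (φ.symm u) ∈ ψ.source → ContDiffAt ℝ ∞ g u := by
    rintro u ⟨hu, hfu⟩
    rw [← contMDiffAt_iff_contDiffAt]
    refine ContMDiffAt.comp u ?_ (hf.contMDiffAt.comp u (contMDiffAt_extChartAt_symm hu))
    exact contMDiffAt_extChartAt' (by rwa [extChartAt_source] at hfu)
  have hcomp : ∀ u, u ∈ φ.target ∧ f (φ.symm u) ∈ ψ.source → ∀ v : E,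
      (mfderiv 𝓘(ℝ, E) 𝓘(ℝ, E') f (φ.symm u) (chartSymmDeriv x u v) : E') =
        chartSymmDeriv (f x) (g u) (fderiv ℝ g u v) := by
    rintro u ⟨hu, hfu⟩ v
    have hgu : g u ∈ ψ.target := ψ.map_source hfu
    have hfd : MDifferentiableAt 𝓘(ℝ, E) 𝓘(ℝ, E') f (φ.symm u) :=
      hf.mdifferentiableAt (by simp)
    have hφd : MDifferentiableAt 𝓘(ℝ, E) 𝓘(ℝ, E) φ.symm u :=
      (contMDiffAt_extChartAt_symm hu).mdifferentiableAt (by simp)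
    have hψd : MDifferentiableAt 𝓘(ℝ, E') 𝓘(ℝ, E') ψ.symm (g u) :=
      (contMDiffAt_extChartAt_symm hgu).mdifferentiableAt (by simp)
    have hgd : MDifferentiableAt 𝓘(ℝ, E) 𝓘(ℝ, E') g u :=
      ((hgsmooth u ⟨hu, hfu⟩).differentiableAt (by simp)).mdifferentiableAt
    have hev : f ∘ φ.symm =ᶠ[𝓝 u] ψ.symm ∘ g := by
      have h1 : ContinuousAt (f ∘ φ.symm) u :=
        hf.continuous.continuousAt.comp hφd.continuousAt
      filter_upwards [h1.preimage_mem_nhds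
        ((isOpen_extChartAt_source (I := 𝓘(ℝ, E')) (f x)).mem_nhds hfu)] with y hy
      exact (ψ.left_inv hy).symm
    have h1 := HasMFDerivAt.comp u hfd.hasMFDerivAt hφd.hasMFDerivAt
    have h2 := (HasMFDerivAt.comp u hψd.hasMFDerivAt hgd.hasMFDerivAt).congr_of_eventuallyEq hev
    have h3 := congrArg (fun L : E →L[ℝ] E' => L v) (hasMFDerivAt_unique h1 h2)
    rw [mfderiv_eq_fderiv] at h3
    exact h3
  have hrel : ∀ (V : ∀ x : M, TangentSpace 𝓘(ℝ, E) x) (V' : ∀ x : M', TangentSpace 𝓘(ℝ, E') x),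
      (∀ y, mfderiv 𝓘(ℝ, E) 𝓘(ℝ, E') f y (V y) = V' (f y)) →
      ∀ᶠ u in 𝓝 (φ x), fderiv ℝ g u (chartField x V u) = chartField (f x) V' (g u) := by
    intro V V' h
    filter_upwards [hdom] with u hu
    have hgu : g u ∈ ψ.target := ψ.map_source hu.2
    have hψg : ψ.symm (g u) = f (φ.symm u) := ψ.left_inv hu.2
    apply (isInvertible_chartSymmDeriv hgu).injective
    rw [← hcomp u hu, chartSymmDeriv_chartField hu.1, chartSymmDeriv_chartField hgu]
    have h2 : ∀ y : M', y = f (φ.symm u) → (V' (f (φ.symm u)) : E') = V' y := by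
      rintro _ rfl; rfl
    exact (h _).trans (h2 _ hψg)
  have hdx := hdom.self_of_nhds
  have key := fderiv_lieBracket_of_related (hgsmooth _ hdx) (differentiableAt_chartField hV)
    (differentiableAt_chartField hW) (V' := chartField (f x) V') (W' := chartField (f x) W')
    (by rw [hg0]; exact differentiableAt_chartField hV')
    (by rw [hg0]; exact differentiableAt_chartField hW') (hrel V V' hVV') (hrel W W' hWW')
  have h3 := hcomp (φ x) hdx (lieBracket ℝ (chartField x V) (chartField x W) (φ x))
  rw [key, hg0, chartSymmDeriv_lieBracket (hV.mdifferentiableAt one_ne_zero)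
    (hW.mdifferentiableAt one_ne_zero), chartSymmDeriv_lieBracket
    (hV'.mdifferentiableAt one_ne_zero) (hW'.mdifferentiableAt one_ne_zero)] at h3
  have h4 : ∀ (y : M) (v : E), y = x → (mfderiv 𝓘(ℝ, E) 𝓘(ℝ, E') f y v : E') =
      mfderiv 𝓘(ℝ, E) 𝓘(ℝ, E') f x v := by
    rintro _ _ rfl; rfl
  exact (h4 _ _ hx).symm.trans h3

end RelatedVectorFields

/-! ### The differential of a Lie group homomorphism -/

section LieGroupHom

open Set Filter Topology VectorField

variable {E E' : Type*} [NormedAddCommGroup E] [NormedSpace ℝ E]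
  [NormedAddCommGroup E'] [NormedSpace ℝ E']
  {G : Type*} [TopologicalSpace G] [ChartedSpace E G] [Group G] [LieGroup 𝓘(ℝ, E) ∞ G]
  {K : Type*} [TopologicalSpace K] [ChartedSpace E' K] [Group K] [LieGroup 𝓘(ℝ, E') ∞ K]

variable (E E') in
/-- The differential at the identity of a homomorphism of Lie groups, as a map between the model
spaces. -/
noncomputable def MonoidHom.differentialOne (f : K →* G) : E' →L[ℝ] E :=
  mfderiv 𝓘(ℝ, E') 𝓘(ℝ, E) f 1

/-- Differentiate f(h x) = f(h) f(x) at x = 1. This relatedness is what makes the differential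
respect brackets. -/
lemma mfderiv_mulInvariantVectorField_monoidHom {f : K →* G}
    (hf : ContMDiff 𝓘(ℝ, E') 𝓘(ℝ, E) ∞ f) (Y : E') (h : K) :
    mfderiv 𝓘(ℝ, E') 𝓘(ℝ, E) f h (mulInvariantVectorField (I := 𝓘(ℝ, E')) (G := K) Y h) =
      mulInvariantVectorField (I := 𝓘(ℝ, E)) (G := G) (f.differentialOne E E' Y : E) (f h) := by
  have hfd : ∀ a, MDifferentiableAt 𝓘(ℝ, E') 𝓘(ℝ, E) f a := fun a =>
    hf.mdifferentiableAt (by simp)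
  have hK : MDifferentiableAt 𝓘(ℝ, E') 𝓘(ℝ, E') (h * ·) (1 : K) :=
    (contMDiff_mul_left (I := 𝓘(ℝ, E')) (n := ∞) (a := h)).contMDiffAt.mdifferentiableAt (by simp)
  have hG : MDifferentiableAt 𝓘(ℝ, E) 𝓘(ℝ, E) (f h * ·) (1 : G) :=
    (contMDiff_mul_left (I := 𝓘(ℝ, E)) (n := ∞) (a := f h)).contMDiffAt.mdifferentiableAt (by simp)
  have key : f ∘ (fun x : K => h * x) = (fun x => f h * x) ∘ f := by
    ext x; simp
  have h1 := mfderiv_comp_of_eq (I := 𝓘(ℝ, E')) (I' := 𝓘(ℝ, E')) (I'' := 𝓘(ℝ, E)) (x := (1 : K))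
    (hfd h) hK (mul_one h)
  have h2 := mfderiv_comp_of_eq (I := 𝓘(ℝ, E')) (I' := 𝓘(ℝ, E)) (I'' := 𝓘(ℝ, E)) (x := (1 : K))
    hG (hfd 1) (map_one f)
  rw [key] at h1
  have h3 := congrArg (fun L : E' →L[ℝ] E => L Y) (h1.symm.trans h2)
  refine Eq.trans ?_ (h3.trans ?_)
  · exact mfderiv_apply_congr_point (E := E) (E' := E') (mul_one h).symm _
  · exact mfderiv_apply_congr_point (E := E) (E' := E) (map_one f) _

lemma MonoidHom.differentialOne_bracket [CompleteSpace E] [CompleteSpace E'] {f : K →* G}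
    (hf : ContMDiff 𝓘(ℝ, E') 𝓘(ℝ, E) ∞ f) (Y Z : GroupLieAlgebra 𝓘(ℝ, E') K) :
    f.differentialOne E E' (⁅Y, Z⁆ : GroupLieAlgebra 𝓘(ℝ, E') K) =
      Bracket.bracket (L := GroupLieAlgebra 𝓘(ℝ, E) G) (M := GroupLieAlgebra 𝓘(ℝ, E) G)
        (f.differentialOne E E' Y) (f.differentialOne E E' Z) := by
  have h1 := mfderiv_mlieBracket_of_related (x := (1 : K)) hf
    (contMDiff_one_mulInvariantVectorField (E := E') (G := K) Y).contMDiffAt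
    (contMDiff_one_mulInvariantVectorField (E := E') (G := K) Z).contMDiffAt
    (contMDiff_one_mulInvariantVectorField (E := E) (G := G)
      (f.differentialOne E E' Y : E)).contMDiffAt
    (contMDiff_one_mulInvariantVectorField (E := E) (G := G)
      (f.differentialOne E E' Z : E)).contMDiffAt
    (mfderiv_mulInvariantVectorField_monoidHom hf Y)
    (mfderiv_mulInvariantVectorField_monoidHom hf Z)
  have h2 : ∀ (V W : ∀ g : G, TangentSpace 𝓘(ℝ, E) g) (g : G), g = 1 →
      (mlieBracket 𝓘(ℝ, E) V W g : E) = mlieBracket 𝓘(ℝ, E) V W 1 := by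
    rintro V W _ rfl; rfl
  exact Eq.trans h1 (h2 _ _ _ (map_one f))

omit [LieGroup 𝓘(ℝ, E) ∞ G] [LieGroup 𝓘(ℝ, E') ∞ K] in
lemma IsOneParameterSubgroup.comp_monoidHom {f : K →* G}
    (hf : ContMDiff 𝓘(ℝ, E') 𝓘(ℝ, E) ∞ f) {Y : E'} {γ : ℝ → K}
    (hγ : IsOneParameterSubgroup (Y : GroupLieAlgebra 𝓘(ℝ, E') K) γ) :
    IsOneParameterSubgroup (f.differentialOne E E' Y : GroupLieAlgebra 𝓘(ℝ, E) G) (f ∘ γ) where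
  map_add s t := by simp [hγ.map_add]
  contMDiff := hf.comp hγ.contMDiff
  velocity := by
    have h1 := mfderiv_comp_of_eq (I := 𝓘(ℝ, ℝ)) (I' := 𝓘(ℝ, E')) (I'' := 𝓘(ℝ, E)) (x := (0 : ℝ))
      (hf.mdifferentiableAt (x := (1 : K)) (by simp))
      (hγ.contMDiff.mdifferentiableAt (x := (0 : ℝ)) (by simp)) hγ.map_zero
    have h2 := congrArg (fun L : ℝ →L[ℝ] E => L 1) h1
    refine h2.trans (Eq.trans ?_ (congrArg (f.differentialOne E E') hγ.velocity))
    exact mfderiv_apply_congr_point (E := E) (E' := E') hγ.map_zero _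

/-- Equal images give f ∘ γ = f ∘ δ by uniqueness of one-parameter subgroups, and injectivity of f
gives γ = δ. -/
lemma MonoidHom.injective_differentialOne [CompleteSpace E] [CompleteSpace E'] [T2Space G]
    [T2Space K] {f : K →* G} (hf : ContMDiff 𝓘(ℝ, E') 𝓘(ℝ, E) ∞ f) (hinj : Function.Injective f) :
    Function.Injective (f.differentialOne E E') := by
  intro Y Z hYZ
  obtain ⟨γ, hγ⟩ := exists_isOneParameterSubgroup (E := E') (G := K) Y
  obtain ⟨δ, hδ⟩ := exists_isOneParameterSubgroup (E := E') (G := K) Z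
  have h1 := hγ.comp_monoidHom hf
  have h2 := hδ.comp_monoidHom hf
  rw [← hYZ] at h2
  have h3 : γ = δ := hinj.comp_left (h1.unique h2)
  subst h3
  exact hγ.velocity.symm.trans hδ.velocity

/-- The Lie algebra homomorphism induced by a homomorphism of Lie groups. -/
noncomputable def MonoidHom.lieHom [CompleteSpace E] [CompleteSpace E'] (f : K →* G)
    (hf : ContMDiff 𝓘(ℝ, E') 𝓘(ℝ, E) ∞ f) :
    GroupLieAlgebra 𝓘(ℝ, E') K →ₗ⁅ℝ⁆ GroupLieAlgebra 𝓘(ℝ, E) G where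
  toFun Y := f.differentialOne E E' Y
  map_add' Y Z := ContinuousLinearMap.map_add (f.differentialOne E E') Y Z
  map_smul' c Y := ContinuousLinearMap.map_smul (f.differentialOne E E') c Y
  map_lie' {Y Z} := f.differentialOne_bracket hf Y Z

end LieGroupHom

/-! ### The Lie algebra of an embedded subgroup -/

section EmbeddedLieSubgroup

open Set Filter Topology VectorField

variable {E : Type*} [NormedAddCommGroup E] [NormedSpace ℝ E]
  {G : Type*} [TopologicalSpace G] [ChartedSpace E G] [Group G] [LieGroup 𝓘(ℝ, E) ∞ G]
  {H : Subgroup G} {k : ℕ} [ChartedSpace (EuclideanSpace ℝ (Fin k)) H] [LieGroup (𝓡 k) ∞ H]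

omit [LieGroup 𝓘(ℝ, E) ∞ G] [LieGroup (𝓡 k) ∞ H] in
lemma IsEmbeddedLieSubgroup.contMDiff_subtype (h : IsEmbeddedLieSubgroup E H k) :
    ContMDiff (𝓡 k) 𝓘(ℝ, E) ∞ H.subtype :=
  h.isSmoothEmbedding.isImmersion.contMDiff

-- One-parameter subgroups of H push forward to G. Conversely, one of G lying in H is smooth as a
-- map into H, because the inclusion is an immersion and H has the subspace topology.
omit [LieGroup 𝓘(ℝ, E) ∞ G] in
lemma IsEmbeddedLieSubgroup.range_differentialOne [T2Space G] (h : IsEmbeddedLieSubgroup E H k) :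
    range (H.subtype.differentialOne E (EuclideanSpace ℝ (Fin k))) =
      subgroupTangent E H := by
  apply Subset.antisymm
  · rintro _ ⟨Y, rfl⟩
    obtain ⟨γ, hγ⟩ := exists_isOneParameterSubgroup (E := EuclideanSpace ℝ (Fin k)) (G := H) Y
    exact ⟨_, hγ.comp_monoidHom h.contMDiff_subtype, fun t => (γ t).2⟩
  · rintro X ⟨γ, hγ, hH⟩
    let δ : ℝ → H := fun t => ⟨γ t, hH t⟩
    have hδ : ContMDiff 𝓘(ℝ, ℝ) (𝓡 k) ∞ δ :=
      (ContMDiff.iff_comp_isImmersion h.isSmoothEmbedding.isImmersion).2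
        ⟨hγ.contMDiff.continuous.subtype_mk _, hγ.contMDiff⟩
    have hδ' : IsOneParameterSubgroup (E := EuclideanSpace ℝ (Fin k)) (G := H)
        (mfderiv 𝓘(ℝ, ℝ) (𝓡 k) δ 0 (1 : ℝ) : EuclideanSpace ℝ (Fin k)) δ :=
      ⟨fun s t => Subtype.ext (hγ.map_add s t), hδ, rfl⟩
    exact ⟨_, (hδ'.comp_monoidHom h.contMDiff_subtype).velocity.symm.trans hγ.velocity⟩

end EmbeddedLieSubgroup

/-! ### The closed subgroup theorem -/

theorem mainTheorem2 {E : Type*} [NormedAddCommGroup E] [NormedSpace ℝ E] [FiniteDimensional ℝ E]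
    {G : Type*} [TopologicalSpace G] [T2Space G] [SecondCountableTopology G]
    [ChartedSpace E G] [Group G] [LieGroup 𝓘(ℝ, E) ∞ G]
    (H : Subgroup G) (hH : IsClosed (H : Set G)) :
    -- `H` is an embedded Lie subgroup of `G`
    (∃ (k : ℕ) (_ : ChartedSpace (EuclideanSpace ℝ (Fin k)) H), IsEmbeddedLieSubgroup E H k) ∧
    -- for every such structure on `H`, the differential at the identity of the inclusion
    -- identifies the Lie algebra of `H` with the Lie subalgebra `{X | ∀ t, exp (t X) ∈ H}`
    ∀ (k : ℕ) [ChartedSpace (EuclideanSpace ℝ (Fin k)) H] [LieGroup (𝓡 k) ∞ H],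
      IsEmbeddedLieSubgroup E H k →
      ∃ (𝔥 : LieSubalgebra ℝ (GroupLieAlgebra 𝓘(ℝ, E) G))
        (φ : GroupLieAlgebra (𝓡 k) H ≃ₗ⁅ℝ⁆ 𝔥),
        (𝔥 : Set (GroupLieAlgebra 𝓘(ℝ, E) G)) = {X | ∀ t : ℝ, lieExp (t • X) ∈ H} ∧
        ∀ Y : GroupLieAlgebra (𝓡 k) H, (φ Y : GroupLieAlgebra 𝓘(ℝ, E) G) =
          mfderiv (𝓡 k) 𝓘(ℝ, E) (Subtype.val : H → G) 1 Y := by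
  have : CompleteSpace E := FiniteDimensional.complete ℝ E
  refine ⟨exists_isEmbeddedLieSubgroup H hH, fun k _ _ h => ?_⟩
  have hf := h.contMDiff_subtype
  -- Taking 𝔥 to be the range of a Lie algebra homomorphism makes closure under brackets automatic;
  -- only its description by exp remains.
  refine ⟨(H.subtype.lieHom hf).range, LieEquiv.ofInjective (H.subtype.lieHom hf)
    (MonoidHom.injective_differentialOne (E := E) (E' := EuclideanSpace ℝ (Fin k)) hf
      Subtype.val_injective), ?_, fun Y => rfl⟩
  ext X
  refine Iff.trans ?_ (mem_subgroupTangent_iff (E := E) (X := X))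
  rw [← h.range_differentialOne]
  exact LieHom.mem_range _ _
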